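/- Let $G=\{(M_1,M_2)\in \mathrm{SL}_2(\mathbb Z)\times \mathrm{SL}_2(\mathbb Z): M_1\equiv M_2 \pmod 2\}$ and let $\mathbb H$ be the upper half-plane. For $k\in\mathbb Z$, a modular form of weight $k$ for $G$ is a holomorphic function $f:\mathbb H\times\mathbb H\to\mathbb C$ satisfying $$f(M_1\tau_1,M_2\tau_2)=(c_1\tau_1+d_1)^k(c_2\tau_2+d_2)^k f(\tau_1,\tau_2)\quad\text{for all } (M_1,M_2)\in G,\ M_i=\begin{pmatrix}a_i&b_i\\c_i&d_i\end{pmatrix},$$ for which the limits $\Phi_1f(\tau)=\lim_{z\to i\infty}f(z,\tau)$ and $\Phi_2f(\tau)=\lim_{z\to i\infty}f(\tau,z)$ exist and are holomorphic modular forms of weight $k$ and level $\Gamma_0(2)$. Let $M_k(G)$ be the space of these forms and $M_*(G)=\bigoplus_{k\in\mathbb Z}M_k(G)$ the graded ring. A form $f$ is symmetric if $f(\tau_1,\tau_2)=f(\tau_2,\tau_1)$ and antisymmetric if $f(\tau_1,\tau_2)=-f(\tau_2,\tau_1)$; let $M_*^{sym}(G)\subseteq M_*(G)$ be the subring, and $M_*^{anti}(G)\subseteq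 M_*(G)$ the $M_*^{sym}(G)$-submodule, of elements all of whose homogeneous components are symmetric, respectively antisymmetric. Let $q=e^{2\pi i\tau}$, $E_2(\tau)=1-24\sum_{n\ge1}\sigma_1(n)q^n$, $\eta(\tau)=q^{1/24}\prod_{n\ge1}(1-q^n)$, $e_1(\tau)=2E_2(2\tau)-E_2(\tau)$, $e_2(\tau)=E_2(\tau)-\tfrac12E_2(\tau/2)$, $f_{ij}(\tau_1,\tau_2)=e_i(\tau_1)e_j(\tau_2)$, and $$X_2=\tfrac43(f_{11}+f_{22})-\tfrac23(f_{12}+f_{21}),\qquad X_4=\tfrac1{144}(f_{12}-f_{21})^2,\qquad \Delta_6(\tau_1,\tau_2)=\eta(\tau_1)^{12}\eta(\tau_2)^{12},$$ $$X_8=\tfrac1{81}(f_{11}-f_{22})(f_{12}-f_{21})(f_{12}+f_{21}-f_{11})(f_{12}+f_{21}-f_{22}).$$ Then $X_2,X_4,\Delta_6,X_8$ are modular forms for $G$ of weights $2,4,6,8$, and $M_*^{anti}(G)$ is a free $M_*^{sym}(G)$-module with the single generator $X_8$. Moreover there is the Hironaka decomposition $$M_*(G)=\mathbb C[X_2,X_4,\Delta_6]\oplus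 X_8\,\mathbb C[X_2,X_4,\Delta_6],$$ in the sense that every $F\in M_*(G)$ can be written as $F=P(X_2,X_4,\Delta_6)+X_8\,Q(X_2,X_4,\Delta_6)$ with unique polynomials $P,Q\in\mathbb C[x_2,x_4,d_6]$; and $$M_*(G)\cong\mathbb C[x_2,x_4,d_6,x_8]/(R)$$ as $\mathbb C$-algebras, by an isomorphism sending the classes of $x_2,x_4,d_6,x_8$ to $X_2,X_4,\Delta_6,X_8$, where $$R=x_8^2-\left(x_2^4x_4^2-128x_2^2x_4^3+4096x_4^4+4x_2^3x_4d_6-2304x_2x_4^2d_6-6912x_4d_6^2\right).$$ -/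

import Mathlib

open scoped MatrixGroups Topology DirectSum

noncomputable section

namespace DegenerateHilbert

open UpperHalfPlane

/-- The group `G` of pairs `(M₁, M₂)` in `SL₂(ℤ) × SL₂(ℤ)` with `M₁ ≡ M₂ (mod 2)`. -/
def G : Subgroup (SL(2, ℤ) × SL(2, ℤ)) where
  carrier := {M | Matrix.SpecialLinearGroup.map (Int.castRingHom (ZMod 2)) M.1 =
    Matrix.SpecialLinearGroup.map (Int.castRingHom (ZMod 2)) M.2}
  one_mem' := by simp
  mul_mem' := by
    intro A B hA hB
    simp only [Set.mem_ofPred_eq, Prod.fst_mul, Prod.snd_mul, map_mul] at *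
    rw [hA, hB]
  inv_mem' := by
    intro A hA
    simp only [Set.mem_ofPred_eq, Prod.fst_inv, Prod.snd_inv, map_inv] at *
    rw [hA]

/-- Modular forms (in one variable) of weight `k` and level `Γ₀(2)`. -/
abbrev Gamma0TwoForm (k : ℤ) : Type :=
  ModularForm ((CongruenceSubgroup.Gamma0 2).map (Matrix.SpecialLinearGroup.mapGL ℝ)) k

/-- `f` is a modular form of weight `k` for `G`. The last two fields say that the limits
`Φ₁ f (τ) = lim_{z → i∞} f (z, τ)` and `Φ₂ f (τ) = lim_{z → i∞} f (τ, z)` exist and are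
holomorphic modular forms of level `Γ₀(2)`. -/
structure IsModularForm (k : ℤ) (f : ℍ × ℍ → ℂ) : Prop where
  holo : DifferentiableOn ℂ (fun p : ℂ × ℂ => f (ofComplex p.1, ofComplex p.2))
    {p | 0 < p.1.im ∧ 0 < p.2.im}
  transform : ∀ M ∈ G, ∀ τ₁ τ₂ : ℍ, f (M.1 • τ₁, M.2 • τ₂) =
    ((M.1 1 0 : ℂ) * τ₁ + (M.1 1 1 : ℂ)) ^ k * ((M.2 1 0 : ℂ) * τ₂ + (M.2 1 1 : ℂ)) ^ k *
      f (τ₁, τ₂)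
  phi₁ : ∃ g : Gamma0TwoForm k, ∀ τ : ℍ,
    Filter.Tendsto (fun z : ℍ => f (z, τ)) atImInfty (𝓝 (g τ))
  phi₂ : ∃ g : Gamma0TwoForm k, ∀ τ : ℍ,
    Filter.Tendsto (fun z : ℍ => f (τ, z)) atImInfty (𝓝 (g τ))

/-- The space `M_k(G)`. -/
def M (k : ℤ) : Submodule ℂ (ℍ × ℍ → ℂ) where
  carrier := {f | IsModularForm k f}
  zero_mem' :=
    { holo := differentiableOn_const (0 : ℂ)
      transform := by simp
      phi₁ := ⟨0, fun τ => by simp⟩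
      phi₂ := ⟨0, fun τ => by simp⟩ }
  add_mem' := by
    intro f g hf hg
    obtain ⟨a₁, ha₁⟩ := hf.phi₁
    obtain ⟨b₁, hb₁⟩ := hg.phi₁
    obtain ⟨a₂, ha₂⟩ := hf.phi₂
    obtain ⟨b₂, hb₂⟩ := hg.phi₂
    exact
      { holo := hf.holo.add hg.holo
        transform := fun A hA τ₁ τ₂ => by
          simp only [Pi.add_apply, hf.transform A hA, hg.transform A hA]; ring
        phi₁ := ⟨a₁ + b₁, fun τ => (ha₁ τ).add (hb₁ τ)⟩
        phi₂ := ⟨a₂ + b₂, fun τ => (ha₂ τ).add (hb₂ τ)⟩ }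
  smul_mem' := by
    intro c f hf
    obtain ⟨a₁, ha₁⟩ := hf.phi₁
    obtain ⟨a₂, ha₂⟩ := hf.phi₂
    exact
      { holo := hf.holo.const_smul c
        transform := fun A hA τ₁ τ₂ => by
          simp only [Pi.smul_apply, smul_eq_mul, hf.transform A hA]; ring
        phi₁ := ⟨c • a₁, fun τ => (ha₁ τ).const_smul c⟩
        phi₂ := ⟨c • a₂, fun τ => (ha₂ τ).const_smul c⟩ }

instance : SetLike.GradedMonoid M where
  one_mem :=
    { holo := differentiableOn_const (1 : ℂ)
      transform := by simp
      phi₁ := ⟨ModularForm.const 1, fun τ => tendsto_const_nhds⟩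
      phi₂ := ⟨ModularForm.const 1, fun τ => tendsto_const_nhds⟩ }
  mul_mem := by
    intro k l f g (hf : IsModularForm k f) (hg : IsModularForm l g)
    obtain ⟨a₁, ha₁⟩ := hf.phi₁
    obtain ⟨b₁, hb₁⟩ := hg.phi₁
    obtain ⟨a₂, ha₂⟩ := hf.phi₂
    obtain ⟨b₂, hb₂⟩ := hg.phi₂
    have den : ∀ (A : SL(2, ℤ)) (τ : ℍ), (A 1 0 : ℂ) * τ + (A 1 1 : ℂ) ≠ 0 := by
      intro A τ
      have := denom_ne_zero (A : GL (Fin 2) ℝ) τ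
      rwa [ModularGroup.denom_apply] at this
    exact
      { holo := hf.holo.mul hg.holo
        transform := fun A hA τ₁ τ₂ => by
          simp only [Pi.mul_apply, hf.transform A hA, hg.transform A hA,
            zpow_add₀ (den A.1 τ₁), zpow_add₀ (den A.2 τ₂)]
          ring
        phi₁ := ⟨a₁.mul b₁, fun τ => (ha₁ τ).mul (hb₁ τ)⟩
        phi₂ := ⟨a₂.mul b₂, fun τ => (ha₂ τ).mul (hb₂ τ)⟩ }

/-- The graded ring `M_*(G) = ⨁ₖ M_k(G)`, a commutative `ℂ`-algebra. -/
abbrev MRing : Type := ⨁ k : ℤ, M k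

/-- `f(τ₁, τ₂) = f(τ₂, τ₁)`. -/
def IsSymm (f : ℍ × ℍ → ℂ) : Prop := ∀ τ₁ τ₂ : ℍ, f (τ₁, τ₂) = f (τ₂, τ₁)

/-- `f(τ₁, τ₂) = -f(τ₂, τ₁)`. -/
def IsAntisymm (f : ℍ × ℍ → ℂ) : Prop := ∀ τ₁ τ₂ : ℍ, f (τ₁, τ₂) = -f (τ₂, τ₁)

lemma coe_algebraMap_apply (c : ℂ) (k : ℤ) :
    ((algebraMap ℂ MRing c) k : ℍ × ℍ → ℂ) =
      fun _ => if k = 0 then c else 0 := by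
  rw [DirectSum.algebraMap_apply]
  split_ifs with h
  · subst h
    rw [DirectSum.of_eq_same, Submodule.setLike.coe_galgebra_toFun]
    rfl
  · rw [DirectSum.of_eq_of_ne _ _ _ h]
    rfl

/-- The ring `M_*^sym(G)` of symmetric modular forms, as a subalgebra of `M_*(G)`: all
homogeneous components are symmetric. -/
def MSym : Subalgebra ℂ MRing where
  carrier := {F | ∀ k : ℤ, IsSymm (F k)}
  add_mem' := by
    intro F F' hF hF' k τ₁ τ₂
    have h := hF k τ₁ τ₂
    have h' := hF' k τ₁ τ₂
    simp only [DirectSum.add_apply, Submodule.coe_add, Pi.add_apply, h, h']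
  mul_mem' := by
    intro F F' hF hF' k τ₁ τ₂
    classical
    rw [DirectSum.coe_mul_apply]
    simp only [Finset.sum_apply, Pi.mul_apply]
    refine Finset.sum_congr rfl fun ij _ => ?_
    rw [hF ij.1 τ₁ τ₂, hF' ij.2 τ₁ τ₂]
  algebraMap_mem' := by
    intro c k τ₁ τ₂
    rw [coe_algebraMap_apply]

/-- The `M_*^sym(G)`-module of antisymmetric modular forms: the elements of `M_*(G)` all of whose
homogeneous components are antisymmetric. -/
def MAnti : Submodule MSym MRing where
  carrier := {F | ∀ k : ℤ, IsAntisymm (F k)}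
  zero_mem' := by intro k τ₁ τ₂; simp
  add_mem' := by
    intro F F' hF hF' k τ₁ τ₂
    have h := hF k τ₁ τ₂
    have h' := hF' k τ₁ τ₂
    simp only [DirectSum.add_apply, Submodule.coe_add, Pi.add_apply, h, h']
    ring
  smul_mem' := by
    intro S F hF k τ₁ τ₂
    change (((S : MRing) * F) k : ℍ × ℍ → ℂ) _ = -(((S : MRing) * F) k : ℍ × ℍ → ℂ) _
    classical
    rw [DirectSum.coe_mul_apply]
    simp only [Finset.sum_apply, Pi.mul_apply, ← Finset.sum_neg_distrib]
    refine Finset.sum_congr rfl fun ij _ => ?_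
    rw [S.2 ij.1 τ₁ τ₂, hF ij.2 τ₁ τ₂]
    ring

/-- `e₁(τ) = 2 E₂(2τ) - E₂(τ)`. -/
def e₁ (τ : ℍ) : ℂ :=
  2 * EisensteinSeries.E2 ((⟨2, by norm_num⟩ : {x : ℝ // 0 < x}) • τ) - EisensteinSeries.E2 τ

/-- `e₂(τ) = E₂(τ) - (1/2) E₂(τ/2)`. -/
def e₂ (τ : ℍ) : ℂ :=
  EisensteinSeries.E2 τ -
    1 / 2 * EisensteinSeries.E2 ((⟨1 / 2, by norm_num⟩ : {x : ℝ // 0 < x}) • τ)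

def f₁₁ (τ : ℍ × ℍ) : ℂ := e₁ τ.1 * e₁ τ.2

def f₁₂ (τ : ℍ × ℍ) : ℂ := e₁ τ.1 * e₂ τ.2

def f₂₁ (τ : ℍ × ℍ) : ℂ := e₂ τ.1 * e₁ τ.2

def f₂₂ (τ : ℍ × ℍ) : ℂ := e₂ τ.1 * e₂ τ.2

def X₂ (τ : ℍ × ℍ) : ℂ := 4 / 3 * (f₁₁ τ + f₂₂ τ) - 2 / 3 * (f₁₂ τ + f₂₁ τ)

def X₄ (τ : ℍ × ℍ) : ℂ := 1 / 144 * (f₁₂ τ - f₂₁ τ) ^ 2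

/-- `Δ₆(τ₁, τ₂) = η(τ₁)¹² η(τ₂)¹²`. -/
def Δ₆ (τ : ℍ × ℍ) : ℂ := ModularForm.eta τ.1 ^ 12 * ModularForm.eta τ.2 ^ 12

def X₈ (τ : ℍ × ℍ) : ℂ :=
  1 / 81 * (f₁₁ τ - f₂₂ τ) * (f₁₂ τ - f₂₁ τ) * (f₁₂ τ + f₂₁ τ - f₁₁ τ) * (f₁₂ τ + f₂₁ τ - f₂₂ τ)

/-- The relation `R`, in the variables `0, 1, 2, 3` standing for `X₂, X₄, Δ₆, X₈`. -/
def R : MvPolynomial (Fin 4) ℂ :=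
  let x₂ : MvPolynomial (Fin 4) ℂ := MvPolynomial.X 0
  let x₄ : MvPolynomial (Fin 4) ℂ := MvPolynomial.X 1
  let d₆ : MvPolynomial (Fin 4) ℂ := MvPolynomial.X 2
  let x₈ : MvPolynomial (Fin 4) ℂ := MvPolynomial.X 3
  x₈ ^ 2 - (x₂ ^ 4 * x₄ ^ 2 - 128 * x₂ ^ 2 * x₄ ^ 3 + 4096 * x₄ ^ 4 + 4 * x₂ ^ 3 * x₄ * d₆
    - 2304 * x₂ * x₄ ^ 2 * d₆ - 6912 * x₄ * d₆ ^ 2)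

end DegenerateHilbert

end

/-! The space of weight two forms for Γ(2) is spanned by `e₁` and `e₂`, and every form of weight
`2n` for Γ(2) is a homogeneous polynomial of degree `n` in them
(`IsGammaTwoForm.mem_weightTwoSpace_pow`): subtract a multiple of a power that is nonzero at i∞,
then divide by `2e₂ - e₁`. This form has no zero in ℍ, because it divides η¹² (`eta12_eq_prod`), and
at the cusps it has only a simple zero at i∞.

Each slice of a form for `G` is a form for Γ(2), so a form for `G` is a finite sum of products
g(τ₁)h(τ₂) of such polynomials (`mem_span_mul_of_slices`), invariant under the diagonal action of
SL₂(ℤ)/Γ(2) ≅ S₃. In the basis u = `eigU`, v = `eigV`, the element ST acts by cube roots of unity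
and S exchanges u and v up to scalars. Averaging over S₃ therefore kills a monomial or symmetrises
it under u ↔ v. The surviving monomials are products of UV, VU, UU³ and VV³, where UV = u(τ₁)v(τ₂)
and so on. Modulo polynomials in `X₂`, `X₄`, `Δ₆`, everything is generated by UV - VU and UU³ - VV³,
whose squares are such polynomials and whose product is a multiple of `X₈`. The symmetrised part
thus lies in ℂ[X₂, X₄, Δ₆] + X₈ ℂ[X₂, X₄, Δ₆] (`IsModularForm.mem_hironaka`).

Uniqueness: the values of (e₁(τ₁), e₂(τ₁), e₁(τ₂), e₂(τ₂)) are Zariski dense in ℂ⁴, and the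
polynomial map ℂ⁴ → ℂ³ behind the three generators hits every point off a hypersurface, so `X₂`,
`X₄`, `Δ₆` are algebraically independent (`aeval_injective`). Exchanging the variables fixes these
and negates `X₈`, which separates the two summands and identifies the antisymmetric forms. The
presentation is division with remainder by `R`, monic of degree two in x₈. -/

noncomputable section

namespace DegenerateHilbert

open UpperHalfPlane Filter EisensteinSeries ModularForm CongruenceSubgroup

open Function.Periodic (qParam)

open scoped Manifold

/-! ### The automorphy cocycle and the slash action. -/

section Automorphy

/-- The automorphy factor `cτ + d`. -/
def autFactor (γ : SL(2, ℤ)) (τ : ℍ) : ℂ := (γ 1 0 : ℂ) * τ + (γ 1 1 : ℂ)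

lemma autFactor_eq_denom (γ : SL(2, ℤ)) (τ : ℍ) : autFactor γ τ = denom γ τ :=
  (ModularGroup.denom_apply γ τ).symm

lemma autFactor_ne_zero (γ : SL(2, ℤ)) (τ : ℍ) : autFactor γ τ ≠ 0 := by
  rw [autFactor_eq_denom]; exact denom_ne_zero _ _

lemma autFactor_mul (A B : SL(2, ℤ)) (τ : ℍ) :
    autFactor (A * B) τ = autFactor A (B • τ) * autFactor B τ := by
  have h0 := autFactor_ne_zero B τ
  simp only [autFactor] at h0 ⊢
  simp only [coe_specialLinearGroup_apply, Matrix.SpecialLinearGroup.coe_mul, Matrix.mul_apply,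
    Fin.sum_univ_two]
  simp
  field_simp
  ring

lemma slash_apply_eq (f : ℍ → ℂ) (k : ℤ) (γ : SL(2, ℤ)) (τ : ℍ) :
    (f ∣[k] γ) τ = autFactor γ τ ^ (-k) * f (γ • τ) := by
  rw [SL_slash_apply, autFactor_eq_denom, mul_comm]

lemma slash_eq_iff (f g : ℍ → ℂ) (k : ℤ) (γ : SL(2, ℤ)) :
    f ∣[k] γ = g ↔ ∀ τ, f (γ • τ) = autFactor γ τ ^ k * g τ := by
  rw [funext_iff]
  refine forall_congr' fun τ => ?_
  rw [slash_apply_eq, zpow_neg, inv_mul_eq_iff_eq_mul₀ (zpow_ne_zero _ (autFactor_ne_zero γ τ))]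

@[simp] lemma autFactor_T (τ : ℍ) : autFactor ModularGroup.T τ = 1 := by
  simp [autFactor, ModularGroup.T]

@[simp] lemma autFactor_S (τ : ℍ) : autFactor ModularGroup.S τ = τ := by
  simp [autFactor, ModularGroup.S]

@[simp] lemma autFactor_one (τ : ℍ) : autFactor 1 τ = 1 := by simp [autFactor]

end Automorphy

/-! ### Transformation laws of `e₁` and `e₂`. -/

section EisensteinTwo

lemma E2_smul (γ : SL(2, ℤ)) (τ : ℍ) :
    E2 (γ • τ) = autFactor γ τ ^ 2 * E2 τ -
      1 / (2 * riemannZeta 2) * (2 * Real.pi * Complex.I) * γ 1 0 * autFactor γ τ := by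
  have h := congrFun (E2_slash_action γ) τ
  rw [slash_apply_eq] at h
  have h0 := autFactor_ne_zero γ τ
  simp only [Pi.sub_apply, Pi.smul_apply, D2, smul_eq_mul, ← autFactor_eq_denom] at h
  have h2 : E2 (γ • τ) = autFactor γ τ ^ (2 : ℤ) * (autFactor γ τ ^ (-2 : ℤ) * E2 (γ • τ)) := by
    rw [← mul_assoc, ← zpow_add₀ h0]; simp
  rw [h2, h, zpow_ofNat]
  field_simp

lemma coe_S_smul (τ : ℍ) : ((ModularGroup.S • τ : ℍ) : ℂ) = -(τ : ℂ)⁻¹ := by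
  rw [modular_S_smul]; simp

lemma S_smul_S_smul (τ : ℍ) : ModularGroup.S • ModularGroup.S • τ = τ := by
  ext
  rw [coe_S_smul, coe_S_smul]; simp

/-- Conjugation by diag(2, 1) turns the action of γ on 2τ into that of γ', whose lower left entry is
half that of γ. The factor 2 in `e₁` then makes the two quasimodular corrections of `E2` cancel. -/
lemma e₁_smul_of_mem_Gamma0 {γ : SL(2, ℤ)} (hγ : γ ∈ Gamma0 2) (τ : ℍ) :
    e₁ (γ • τ) = autFactor γ τ ^ 2 * e₁ τ := by
  obtain ⟨c, hc⟩ : (2 : ℤ) ∣ γ 1 0 := by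
    rw [Gamma0_mem] at hγ
    exact (ZMod.intCast_zmod_eq_zero_iff_dvd _ 2).mp hγ
  have hdet : γ 0 0 * γ 1 1 - γ 0 1 * γ 1 0 = 1 := (Matrix.det_fin_two γ.1).symm.trans γ.2
  let γ' : SL(2, ℤ) := ⟨!![γ 0 0, 2 * γ 0 1; c, γ 1 1], by
    rw [Matrix.det_fin_two_of]; rw [hc] at hdet; linarith⟩
  let t : {x : ℝ // 0 < x} := ⟨2, by norm_num⟩
  have hj : autFactor γ' (t • τ) = autFactor γ τ := by
    simp only [autFactor, coe_pos_real_smul, γ', t, hc]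
    simp
    ring
  have hs : t • (γ • τ) = γ' • (t • τ) := by
    ext
    have h0 := autFactor_ne_zero γ τ
    have h1 := autFactor_ne_zero γ' (t • τ)
    simp only [coe_pos_real_smul, coe_specialLinearGroup_apply]
    simp only [autFactor, coe_pos_real_smul, γ', t, hc] at h0 h1 ⊢
    simp at h0 h1 ⊢
    field_simp
  have hd : γ' 1 0 = c := rfl
  change 2 * E2 (t • (γ • τ)) - E2 (γ • τ) = _ * (2 * E2 (t • τ) - E2 τ)
  rw [hs, E2_smul, E2_smul γ, hj, hc, hd]
  push_cast
  ring

lemma e₁_S_smul (τ : ℍ) : e₁ (ModularGroup.S • τ) = -(τ : ℂ) ^ 2 * e₂ τ := by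
  let t : {x : ℝ // 0 < x} := ⟨2, by norm_num⟩
  let t' : {x : ℝ // 0 < x} := ⟨1 / 2, by norm_num⟩
  have hs : t • (ModularGroup.S • τ) = ModularGroup.S • (t' • τ) := by
    ext
    have := τ.ne_zero
    simp only [coe_S_smul, coe_pos_real_smul, t, t', Complex.real_smul]
    push_cast
    field_simp
  have ht : ((t' • τ : ℍ) : ℂ) = τ / 2 := by
    simp [t', coe_pos_real_smul]; ring
  change 2 * E2 (t • (ModularGroup.S • τ)) - E2 (ModularGroup.S • τ) =
    _ * (E2 τ - 1 / 2 * E2 (t' • τ))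
  rw [hs, E2_smul, E2_smul, autFactor_S, autFactor_S, ht]
  ring

lemma e₂_S_smul (τ : ℍ) : e₂ (ModularGroup.S • τ) = -(τ : ℂ) ^ 2 * e₁ τ := by
  have h := e₁_S_smul (ModularGroup.S • τ)
  have := τ.ne_zero
  rw [S_smul_S_smul, coe_S_smul] at h
  rw [h]
  field_simp

/-- The power series `1 - 24 ∑ σ₁(n) xⁿ`. -/
def E2Series (x : ℂ) : ℂ := 1 - 24 * ∑' n : ℕ+, ArithmeticFunction.sigma 1 n * x ^ (n : ℕ)

lemma E2_eq_E2Series (τ : ℍ) :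
    E2 τ = E2Series (Complex.exp (2 * Real.pi * Complex.I * τ)) := E2_eq_tsum_cexp τ

/-- The terms `n xⁿ / (1 - xⁿ)` of the Lambert series of `σ₁`. -/
def lambertTerm (x : ℂ) (n : ℕ) : ℂ := n * x ^ n / (1 - x ^ n)

lemma summable_lambertTerm {x : ℂ} (hx : ‖x‖ < 1) : Summable (lambertTerm x) := by
  simpa [lambertTerm] using! summable_norm_pow_mul_geometric_div_one_sub 1 hx

lemma E2Series_eq_lambert {x : ℂ} (hx : ‖x‖ < 1) :
    E2Series x = 1 - 24 * ∑' n, lambertTerm x n := by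
  rw [E2Series, ← tsum_pow_div_one_sub_eq_tsum_sigma hx,
    ← tsum_zero_pnat_eq_tsum_nat (summable_lambertTerm hx)]
  simp [lambertTerm]

lemma lambertTerm_sq_even (x : ℂ) (n : ℕ) :
    lambertTerm x (2 * n) = 2 * lambertTerm (x ^ 2) n := by
  rw [lambertTerm, lambertTerm, ← pow_mul]; push_cast; ring

lemma lambertTerm_add_neg_odd {x : ℂ} (hx : ‖x‖ < 1) (n : ℕ) :
    lambertTerm x (2 * n + 1) + lambertTerm (-x) (2 * n + 1) =
      2 * lambertTerm (x ^ 2) (2 * n + 1) := by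
  have hy : ‖x ^ (2 * n + 1)‖ < 1 := by
    simpa using pow_lt_one₀ (norm_nonneg x) hx (2 * n).succ_ne_zero
  have h2 : (x ^ 2) ^ (2 * n + 1) = (x ^ (2 * n + 1)) ^ 2 := by rw [← pow_mul, ← pow_mul, mul_comm]
  rw [lambertTerm, lambertTerm, lambertTerm, Odd.neg_pow ⟨n, rfl⟩, h2]
  generalize x ^ (2 * n + 1) = y at hy
  have h1 : 1 - y ≠ 0 := fun h => by simp [← sub_eq_zero.mp h] at hy
  have h2 : 1 + y ≠ 0 := fun h => by simp [eq_neg_of_add_eq_zero_right h] at hy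
  have h3 : 1 - y ^ 2 ≠ 0 := by
    -- With y = x^(2n+1), the claim is y/(1 - y) - y/(1 + y) = 2y²/(1 - y²).
    rw [show 1 - y ^ 2 = (1 - y) * (1 + y) by ring]; exact mul_ne_zero h1 h2
  rw [sub_neg_eq_add]
  field_simp
  ring

/-- The Hecke relation at `2` for the weight two Eisenstein series. -/
lemma E2Series_hecke {x : ℂ} (hx : ‖x‖ < 1) :
    E2Series x + E2Series (-x) + 4 * E2Series (x ^ 4) = 6 * E2Series (x ^ 2) := by
  have hx' : ‖-x‖ < 1 := by simpa
  have hx2 : ‖x ^ 2‖ < 1 := by simpa using pow_lt_one₀ (norm_nonneg x) hx two_ne_zero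
  have hx4 : ‖x ^ 4‖ < 1 := by simpa using pow_lt_one₀ (norm_nonneg x) hx four_ne_zero
  rw [E2Series_eq_lambert hx, E2Series_eq_lambert hx', E2Series_eq_lambert hx2,
    E2Series_eq_lambert hx4]
  have s1 := summable_lambertTerm hx
  have s2 := summable_lambertTerm hx'
  have s3 := summable_lambertTerm hx2
  have he : Function.Injective fun n : ℕ => 2 * n := mul_right_injective₀ two_ne_zero
  have ho : Function.Injective fun n : ℕ => 2 * n + 1 := fun a b h => by simpa using h
  have s12 := s1.add s2
  have t12 := tsum_even_add_odd (f := fun n => lambertTerm x n + lambertTerm (-x) n)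
    (s12.comp_injective he) (s12.comp_injective ho)
  have t3 := tsum_even_add_odd (s3.comp_injective he) (s3.comp_injective ho)
  rw [s1.tsum_add s2] at t12
  have h4 : (x ^ 2) ^ 2 = x ^ 4 := by ring
  simp only [lambertTerm_sq_even, neg_sq, lambertTerm_add_neg_odd hx, ← two_mul,
    tsum_mul_left, h4] at t12 t3
  -- With L the Lambert sum, the parity splittings give L(x) + L(-x) = 4L(x²) + 2·odd and L(x²) =
  -- 2L(x⁴) + odd, where odd is the odd part of L(x²). Eliminate odd.
  linear_combination 24 * t12 - 48 * t3

lemma e₁_T_smul (τ : ℍ) : e₁ (ModularGroup.T • τ) = e₁ τ := by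
  rw [e₁_smul_of_mem_Gamma0 (by rw [Gamma0_mem]; simp [ModularGroup.T])]
  simp

/-- Puts `E2` at 2τ, τ and τ/2 on the common parameter exp(πiτ), as `E2Series` at its fourth, second
and first powers. -/
lemma exp_eq_qParam_two_pow (τ : ℍ) (t : {x : ℝ // 0 < x}) (n : ℕ) (hn : (2 * t : ℝ) = n) :
    Complex.exp (2 * Real.pi * Complex.I * (t • τ : ℍ)) = Function.Periodic.qParam 2 τ ^ n := by
  rw [Function.Periodic.qParam, ← Complex.exp_nat_mul, coe_pos_real_smul, Complex.real_smul]
  congr 1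
  have : (n : ℂ) = 2 * (t : ℝ) := by exact_mod_cast hn.symm
  rw [this]
  push_cast
  ring

lemma E2_eq_E2Series_sq (τ : ℍ) : E2 τ = E2Series (Function.Periodic.qParam 2 τ ^ 2) := by
  rw [E2_eq_E2Series, ← exp_eq_qParam_two_pow τ 1 2 (by simp), one_smul]

lemma e₁_eq_E2Series (τ : ℍ) : e₁ τ = 2 * E2Series (Function.Periodic.qParam 2 τ ^ 4) -
    E2Series (Function.Periodic.qParam 2 τ ^ 2) := by
  rw [e₁, E2_eq_E2Series_sq τ, E2_eq_E2Series, exp_eq_qParam_two_pow τ _ 4 (by norm_num)]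

lemma e₂_eq_E2Series (τ : ℍ) : e₂ τ = E2Series (Function.Periodic.qParam 2 τ ^ 2) -
    1 / 2 * E2Series (Function.Periodic.qParam 2 τ) := by
  rw [e₂, E2_eq_E2Series_sq τ, E2_eq_E2Series, exp_eq_qParam_two_pow τ _ 1 (by norm_num), pow_one]

lemma qParam_two_T_smul (τ : ℍ) : Function.Periodic.qParam 2 (ModularGroup.T • τ : ℍ) =
    -Function.Periodic.qParam 2 τ := by
  rw [modular_T_smul, coe_vadd, Function.Periodic.qParam, Function.Periodic.qParam,
    ← Complex.exp_add_pi_mul_I]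
  congr 1
  push_cast
  ring

lemma norm_qParam_two_lt_one (τ : ℍ) : ‖Function.Periodic.qParam 2 τ‖ < 1 :=
  Function.Periodic.norm_qParam_lt_one two_pos τ.2

/-- Since T negates exp(πiτ), this is the Hecke relation at 2 in disguise. -/
lemma e₂_T_smul (τ : ℍ) : e₂ (ModularGroup.T • τ) = e₁ τ - e₂ τ := by
  have h := E2Series_hecke (norm_qParam_two_lt_one τ)
  rw [e₂_eq_E2Series, e₂_eq_E2Series, e₁_eq_E2Series, qParam_two_T_smul, neg_sq]
  linear_combination -1 / 2 * h

end EisensteinTwo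

/-! ### Holomorphy of `e₁` and `e₂`, and their behaviour at i∞. -/

lemma mdifferentiable_E2_pos_smul (t : {x : ℝ // 0 < x}) : MDiff fun τ : ℍ => E2 (t • τ) := by
  have h := UpperHalfPlane.mdifferentiable_iff.mp E2_mdifferentiable
  rw [UpperHalfPlane.mdifferentiable_iff]
  have h2 : DifferentiableOn ℂ ((E2 ∘ ofComplex) ∘ fun z : ℂ => (t : ℂ) * z)
      {z : ℂ | 0 < z.im} :=
    h.comp (by fun_prop) fun z hz => by simpa using mul_pos t.2 hz
  refine h2.congr fun z hz => ?_
  have hz' : 0 < ((t : ℂ) * z).im := by simpa using mul_pos t.2 hz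
  simp only [Function.comp_apply]
  rw [ofComplex_apply_of_im_pos hz, ofComplex_apply_of_im_pos hz']
  congr 1

lemma mdifferentiable_e₁ : MDiff e₁ :=
  ((mdifferentiable_const (c := (2 : ℂ))).mul (mdifferentiable_E2_pos_smul _)).sub
    E2_mdifferentiable

lemma mdifferentiable_e₂ : MDiff e₂ :=
  E2_mdifferentiable.sub
    ((mdifferentiable_const (c := (1 / 2 : ℂ))).mul (mdifferentiable_E2_pos_smul _))

lemma E2Series_zero : E2Series 0 = 1 := by
  simp [E2Series]

lemma periodic_E2_ofComplex : Function.Periodic (E2 ∘ ofComplex) (1 : ℝ) := by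
  intro w
  by_cases! hw : 0 < w.im
  · have hw' : 0 < (w + (1 : ℝ)).im := by simpa using hw
    simp only [Function.comp_apply, E2_eq_E2Series, ofComplex_apply_of_im_pos hw,
      ofComplex_apply_of_im_pos hw']
    congr 1
    rw [← Complex.exp_periodic (2 * Real.pi * Complex.I * w)]
    congr 1
    push_cast
    ring
  -- Off the half-plane `ofComplex` takes one default value, so periodicity holds there too.
  · have hw' : (w + (1 : ℝ)).im ≤ 0 := by simpa using hw
    simp only [Function.comp_apply, ofComplex_apply_of_im_nonpos hw,
      ofComplex_apply_of_im_nonpos hw']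

/-- Near 0 the series agrees with the cusp function of `E2`; its linear coefficient is what makes
the zero of `2e₂ - e₁` at i∞ simple. -/
lemma hasDerivAt_E2Series : HasDerivAt E2Series (-24) 0 := by
  have han := analyticAt_cuspFunction_zero one_pos periodic_E2_ofComplex E2_mdifferentiable
    isBoundedAtImInfty_E2
  have hs := hasFPowerSeriesOnBall_cuspFunction one_pos han (f := E2) fun τ => by
    simpa only [Function.Periodic.qParam, Complex.ofReal_one, div_one] using
      hasSum_qExpansion_E2 (z := τ)
  have h1 := hs.hasFPowerSeriesAt.hasDerivAt
  simp [FormalMultilinearSeries.coeff_ofScalars] at h1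
  refine h1.congr_of_eventuallyEq ?_
  filter_upwards [Metric.ball_mem_nhds (0 : ℂ) one_pos] with q hq
  have hsum := hs.hasSum (y := q) (by
    rw [mem_ball_zero_iff] at hq
    simpa [Metric.mem_eball, ← ofReal_norm] using hq)
  rw [zero_add] at hsum
  rw [← hsum.tsum_eq, ← tsum_zero_pnat_eq_tsum_nat hsum.summable, E2Series, ← tsum_mul_left]
  simp [sub_eq_add_neg, ← tsum_neg, mul_left_comm, mul_comm]

lemma tendsto_qParam_two :
    Tendsto (fun τ : ℍ => qParam 2 τ) atImInfty (𝓝[≠] 0) :=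
  (Function.Periodic.qParam_tendsto two_pos).comp tendsto_coe_atImInfty

lemma tendsto_e₁ : Tendsto e₁ atImInfty (𝓝 1) := by
  have hc := hasDerivAt_E2Series.continuousAt
  have h : ContinuousAt (fun x => 2 * E2Series (x ^ 4) - E2Series (x ^ 2)) 0 := by
    have h4 : ContinuousAt (fun x => E2Series (x ^ 4)) 0 :=
      ContinuousAt.comp (g := E2Series) (by simpa using hc) (continuousAt_id.pow 4)
    have h2 : ContinuousAt (fun x => E2Series (x ^ 2)) 0 :=
      ContinuousAt.comp (g := E2Series) (by simpa using hc) (continuousAt_id.pow 2)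
    fun_prop
  have h' := h.tendsto.comp (tendsto_qParam_two.mono_right nhdsWithin_le_nhds)
  refine (h'.congr fun τ => (e₁_eq_E2Series τ).symm).trans_eq ?_
  norm_num [E2Series_zero]

lemma tendsto_e₂ : Tendsto e₂ atImInfty (𝓝 (1 / 2)) := by
  have hc := hasDerivAt_E2Series.continuousAt
  have h : ContinuousAt (fun x => E2Series (x ^ 2) - 1 / 2 * E2Series x) 0 := by
    have h2 : ContinuousAt (fun x => E2Series (x ^ 2)) 0 :=
      ContinuousAt.comp (g := E2Series) (by simpa using hc) (continuousAt_id.pow 2)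
    fun_prop
  have h' := h.tendsto.comp (tendsto_qParam_two.mono_right nhdsWithin_le_nhds)
  refine (h'.congr fun τ => (e₂_eq_E2Series τ).symm).trans_eq ?_
  norm_num [E2Series_zero]

lemma tendsto_two_mul_e₂_sub_e₁_div :
    Tendsto (fun τ : ℍ => (2 * e₂ τ - e₁ τ) / qParam 2 τ) atImInfty (𝓝 24) := by
  have hd := hasDerivAt_E2Series
  have h : HasDerivAt (fun x => 3 * E2Series (x ^ 2) - E2Series x - 2 * E2Series (x ^ 4)) 24 0 := by
    have h4 : HasDerivAt (fun x => E2Series (x ^ 4)) (-24 * (4 * 0 ^ 3)) 0 :=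
      HasDerivAt.comp (h₂ := E2Series) 0 (by simpa using hd)
        (by simpa using hasDerivAt_pow 4 (0 : ℂ))
    have h2 : HasDerivAt (fun x => E2Series (x ^ 2)) (-24 * (2 * 0)) 0 :=
      HasDerivAt.comp (h₂ := E2Series) 0 (by simpa using hd)
        (by simpa using hasDerivAt_pow 2 (0 : ℂ))
    exact (((h2.const_mul 3).sub hd).sub (h4.const_mul 2)).congr_deriv (by norm_num)
  have h' := h.tendsto_slope.comp tendsto_qParam_two
  refine h'.congr fun τ => ?_
  simp only [Function.comp_apply, slope_def_field, e₁_eq_E2Series, e₂_eq_E2Series]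
  norm_num [E2Series_zero]
  ring

/-! ### The form η¹² and its factorisation. -/

section Eta

/-- `η¹²` as a function on the upper half-plane. -/
def eta12 (τ : ℍ) : ℂ := ModularForm.eta τ ^ 12

lemma eta12_ne_zero (τ : ℍ) : eta12 τ ≠ 0 := pow_ne_zero _ (ModularForm.eta_ne_zero τ.2)

lemma mdifferentiable_eta12 : MDiff eta12 := by
  rw [UpperHalfPlane.mdifferentiable_iff]
  refine DifferentiableOn.congr (f := fun z => ModularForm.eta z ^ 12) (fun z hz ↦
    ((differentiableAt_eta_of_mem_upperHalfPlaneSet hz).pow 12).differentiableWithinAt)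
    fun z hz ↦ ?_
  simp [eta12, ofComplex_apply_of_im_pos hz]

lemma eta12_eq (τ : ℍ) :
    eta12 τ = qParam 2 τ * (∏' n : ℕ, (1 - (qParam 2 τ ^ 2) ^ (n + 1))) ^ 12 := by
  rw [eta12, ModularForm.eta, mul_pow]
  have h2 : qParam 2 τ ^ 2 = Complex.exp (2 * Real.pi * Complex.I * τ) := by
    rw [← exp_eq_qParam_two_pow τ 1 2 (by simp), one_smul]
  congr 1
  · rw [qParam, qParam, ← Complex.exp_nat_mul]
    congr 1
    push_cast
    ring
  · simp only [ModularForm.eta_q_eq_pow, h2]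

lemma tendsto_eta12_div :
    Tendsto (fun τ : ℍ => eta12 τ / qParam 2 τ) atImInfty (𝓝 1) := by
  have hc : ContinuousAt (fun q : ℂ => ∏' n : ℕ, (1 - q ^ (n + 1))) 0 :=
    (differentiableOn_tprod_one_sub_pow.differentiableAt
      (Metric.ball_mem_nhds 0 one_pos)).continuousAt
  have h : ContinuousAt (fun x : ℂ => (∏' n : ℕ, (1 - (x ^ 2) ^ (n + 1))) ^ 12) 0 :=
    (ContinuousAt.comp (g := fun q : ℂ => ∏' n : ℕ, (1 - q ^ (n + 1)))
      (f := fun x : ℂ => x ^ 2) (by simpa using hc) (by fun_prop)).pow 12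
  have h' := h.tendsto.comp (tendsto_qParam_two.mono_right nhdsWithin_le_nhds)
  refine (h'.congr fun τ => ?_).trans_eq (by simp)
  rw [eta12_eq, mul_div_cancel_left₀ _ (Function.Periodic.qParam_ne_zero _)]
  rfl

lemma eta12_T_smul (τ : ℍ) : eta12 (ModularGroup.T • τ) = -eta12 τ := by
  rw [eta12_eq, eta12_eq, qParam_two_T_smul, neg_sq]
  ring

lemma eta12_S_smul (τ : ℍ) : eta12 (ModularGroup.S • τ) = -(τ : ℂ) ^ 6 * eta12 τ := by
  have h := eta_comp_eq_csqrt_I_inv τ.2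
  simp only [Function.comp_apply, Pi.smul_apply, Pi.mul_apply, smul_eq_mul] at h
  have hI : Complex.sqrt Complex.I ^ 12 = -1 := by
    rw [sqrt_eq_exp Complex.I_ne_zero, ← Complex.exp_nat_mul]
    rw [show ((12 : ℕ) : ℂ) * (Complex.log Complex.I / 2) = (6 : ℕ) * Complex.log Complex.I by
      push_cast; ring, Complex.exp_nat_mul, Complex.exp_log Complex.I_ne_zero,
      show (6 : ℕ) = 4 + 2 by rfl, pow_add, Complex.I_pow_four, Complex.I_sq, one_mul]
  have hτ : Complex.sqrt (τ : ℂ) ^ 12 = (τ : ℂ) ^ 6 := by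
    rw [sqrt_eq_exp τ.ne_zero, ← Complex.exp_nat_mul]
    rw [show ((12 : ℕ) : ℂ) * (Complex.log τ / 2) = (6 : ℕ) * Complex.log τ by
      push_cast; ring, Complex.exp_nat_mul, Complex.exp_log τ.ne_zero]
  rw [eta12, eta12, coe_S_smul, show -(τ : ℂ)⁻¹ = -1 / τ by ring, h, mul_pow, mul_pow, inv_pow,
    hI, hτ]
  ring

/-- The factorisation of `η¹²` into forms of weight two. -/
lemma eta12_eq_prod (τ : ℍ) :
    54 * eta12 τ = (2 * e₂ τ - e₁ τ) * (2 * e₁ τ - e₂ τ) * (e₁ τ + e₂ τ) := by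
  -- Up to automorphy factors and signs, S and T permute the three linear factors, with the same
  -- total sign as for η¹². The quotient is thus a level one form of weight 0, hence constant, equal
  -- to its limit 24 · 3/2 · 3/2 = 54.
  let g : ℍ → ℂ := fun τ => (2 * e₂ τ - e₁ τ) * (2 * e₁ τ - e₂ τ) * (e₁ τ + e₂ τ) / eta12 τ
  have hlim : Tendsto g atImInfty (𝓝 54) := by
    have h := ((tendsto_two_mul_e₂_sub_e₁_div.mul ((tendsto_e₁.const_mul 2).sub tendsto_e₂)).mul
      (tendsto_e₁.add tendsto_e₂)).div tendsto_eta12_div one_ne_zero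
    refine (h.congr fun τ => ?_).trans_eq (by norm_num)
    have h1 := Function.Periodic.qParam_ne_zero (h := 2) (τ : ℂ)
    have h2 := eta12_ne_zero τ
    simp only [Pi.div_apply, g]
    field_simp
  have hS : g ∣[(0 : ℤ)] ModularGroup.S = g := (slash_eq_iff ..).mpr fun τ => by
    have h1 := τ.ne_zero
    have h2 := eta12_ne_zero τ
    simp only [g, e₁_S_smul, e₂_S_smul, eta12_S_smul, zpow_zero, one_mul]
    field_simp
    ring
  have hT : g ∣[(0 : ℤ)] ModularGroup.T = g := (slash_eq_iff ..).mpr fun τ => by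
    have h2 := eta12_ne_zero τ
    simp only [g, e₁_T_smul, e₂_T_smul, eta12_T_smul, zpow_zero, one_mul]
    field_simp
    ring
  have hinv := SlashInvariantForm.slash_action_generators_SL2Z hS hT
  let F : ModularForm 𝒮ℒ 0 :=
    { toFun := g
      slash_action_eq' := by
        rintro _ ⟨A, rfl⟩
        exact hinv A
      holo' := by
        have h := UpperHalfPlane.mdifferentiable_iff.mp
          ((((mdifferentiable_const (c := (2 : ℂ))).mul mdifferentiable_e₂).sub
          mdifferentiable_e₁).mul (((mdifferentiable_const (c := (2 : ℂ))).mul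
          mdifferentiable_e₁).sub mdifferentiable_e₂) |>.mul
          (mdifferentiable_e₁.add mdifferentiable_e₂))
        exact UpperHalfPlane.mdifferentiable_iff.mpr
          (h.div (UpperHalfPlane.mdifferentiable_iff.mp mdifferentiable_eta12)
            fun z _ => eta12_ne_zero _)
      bdd_at_cusps' := by
        intro c hc
        rw [OnePoint.isBoundedAt_iff_forall_SL2Z hc]
        intro γ _
        rw [hinv γ]
        exact hlim.isBigO_one ℝ }
  obtain ⟨c, hc⟩ := ModularForm.eq_const_of_weight_zero F
  replace hc : g = Function.const ℍ c := hc
  have h54 : c = 54 := tendsto_nhds_unique (hc ▸ tendsto_const_nhds) hlim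
  have h := congrFun hc τ
  simp only [g, Function.const_apply, h54] at h
  rw [div_eq_iff (eta12_ne_zero τ)] at h
  exact h.symm

lemma two_mul_e₂_sub_e₁_ne_zero (τ : ℍ) : 2 * e₂ τ - e₁ τ ≠ 0 := fun h => by
  have h' := eta12_eq_prod τ
  rw [h, zero_mul, zero_mul] at h'
  exact mul_ne_zero (by norm_num) (eta12_ne_zero τ) h'

end Eta

/-! ### The ring of modular forms for Γ(2). -/

/-- Holomorphic modular forms of weight `k` for `Γ(2)`, as a predicate on functions. -/
structure IsGammaTwoForm (k : ℤ) (f : ℍ → ℂ) : Prop where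
  holo : MDiff f
  slash : ∀ γ ∈ Gamma 2, f ∣[k] γ = f
  bdd : ∀ γ : SL(2, ℤ), IsBoundedAtImInfty (f ∣[k] γ)

/-- The six cosets are arranged by cusp: w chooses one of the three cusps of Γ(2), and t lies in the
stabiliser of i∞, so growth need only be tested on the three translates by w. -/
lemma exists_rep_Gamma_two (γ : SL(2, ℤ)) : ∃ w ∈ ({1, ModularGroup.S,
    ModularGroup.T * ModularGroup.S} : Set SL(2, ℤ)), ∃ t ∈ ({1, ModularGroup.T} : Set SL(2, ℤ)),
      ∃ δ ∈ Gamma 2, γ = δ * (w * t) := by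
  have key : ∀ A : Matrix (Fin 2) (Fin 2) (ZMod 2), A.det = 1 → A = 1 ∨
      A = !![1, 1; 0, 1] ∨ A = !![0, 1; 1, 0] ∨ A = !![0, 1; 1, 1] ∨
      A = !![1, 1; 1, 0] ∨ A = !![1, 0; 1, 1] := by
    decide
  let red := Matrix.SpecialLinearGroup.map (n := Fin 2) (Int.castRingHom (ZMod 2))
  have lift : ∀ w t : SL(2, ℤ), (red γ).1 = (red (w * t)).1 →
      ∃ δ ∈ Gamma 2, γ = δ * (w * t) := fun w t h =>
    ⟨γ * (w * t)⁻¹, by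
      rw [Gamma_mem', map_mul, map_inv, mul_inv_eq_one]; exact Subtype.ext h, by group⟩
  rcases key (red γ).1 (red γ).2 with h | h | h | h | h | h
  · exact ⟨1, by simp, 1, by simp, lift _ _ (h.trans (by decide))⟩
  · exact ⟨1, by simp, ModularGroup.T, by simp, lift _ _ (h.trans (by decide))⟩
  · exact ⟨ModularGroup.S, by simp, 1, by simp, lift _ _ (h.trans (by decide))⟩
  · exact ⟨ModularGroup.S, by simp, ModularGroup.T, by simp, lift _ _ (h.trans (by decide))⟩
  · exact ⟨ModularGroup.T * ModularGroup.S, by simp, 1, by simp, lift _ _ (h.trans (by decide))⟩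
  · exact ⟨ModularGroup.T * ModularGroup.S, by simp, ModularGroup.T, by simp,
      lift _ _ (h.trans (by decide))⟩

namespace IsGammaTwoForm

variable {k l : ℤ} {f g : ℍ → ℂ}

lemma of_cusps (holo : MDiff f) (slash : ∀ γ ∈ Gamma 2, f ∣[k] γ = f)
    (h1 : IsBoundedAtImInfty f) (hS : IsBoundedAtImInfty (f ∣[k] ModularGroup.S))
    (hTS : IsBoundedAtImInfty (f ∣[k] (ModularGroup.T * ModularGroup.S))) :
    IsGammaTwoForm k f := by
  refine ⟨holo, slash, fun γ => ?_⟩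
  obtain ⟨w, hw, t, ht, δ, hδ, rfl⟩ := exists_rep_Gamma_two γ
  rw [SlashAction.slash_mul, slash δ hδ, SlashAction.slash_mul]
  have hb : IsBoundedAtImInfty (f ∣[k] w) := by
    rcases hw with rfl | rfl | rfl
    · simpa using h1
    · exact hS
    · exact hTS
  rcases ht with rfl | rfl
  · simpa using hb
  · exact hb.slash k (g := (ModularGroup.T : GL (Fin 2) ℝ)) (by
      change ((0 : ℤ) : ℝ) = 0; simp)

lemma smul_apply (hf : IsGammaTwoForm k f) {γ : SL(2, ℤ)} (hγ : γ ∈ Gamma 2) (τ : ℍ) :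
    f (γ • τ) = autFactor γ τ ^ k * f τ :=
  (slash_eq_iff _ _ _ _).mp (hf.slash γ hγ) τ

lemma add (hf : IsGammaTwoForm k f) (hg : IsGammaTwoForm k g) : IsGammaTwoForm k (f + g) where
  holo := hf.holo.add hg.holo
  slash γ hγ := by rw [SlashAction.add_slash, hf.slash γ hγ, hg.slash γ hγ]
  bdd γ := by rw [SlashAction.add_slash]; exact (hf.bdd γ).add (hg.bdd γ)

lemma const_smul (hf : IsGammaTwoForm k f) (c : ℂ) : IsGammaTwoForm k (c • f) where
  holo := hf.holo.const_smul c
  slash γ hγ := by rw [SL_smul_slash, hf.slash γ hγ]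
  bdd γ := by rw [SL_smul_slash]; exact (hf.bdd γ).const_smul_left c

lemma sub (hf : IsGammaTwoForm k f) (hg : IsGammaTwoForm k g) : IsGammaTwoForm k (f - g) := by
  simpa [sub_eq_add_neg] using hf.add (hg.const_smul (-1))

lemma mul (hf : IsGammaTwoForm k f) (hg : IsGammaTwoForm l g) :
    IsGammaTwoForm (k + l) (f * g) where
  holo := hf.holo.mul hg.holo
  slash γ hγ := by rw [mul_slash_SL2, hf.slash γ hγ, hg.slash γ hγ]
  bdd γ := by rw [mul_slash_SL2]; exact (hf.bdd γ).mul (hg.bdd γ)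

lemma one : IsGammaTwoForm 0 1 where
  holo := mdifferentiable_const
  slash γ _ := is_invariant_one γ
  bdd γ := by
    rw [is_invariant_one γ]
    exact Filter.const_boundedAtFilter _ (1 : ℂ)

lemma pow (hf : IsGammaTwoForm k f) (n : ℕ) : IsGammaTwoForm (n * k) (f ^ n) := by
  induction n with
  | zero => simpa using one
  | succ n ih => convert ih.mul hf using 1 <;> [(push_cast; ring); exact pow_succ f n]

/-- The bundled modular form. -/
def toModularForm (hf : IsGammaTwoForm k f) : ModularForm (Gamma 2) k where
  toFun := f
  slash_action_eq' := by
    rintro _ ⟨γ, hγ, rfl⟩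
    exact hf.slash γ hγ
  holo' := hf.holo
  bdd_at_cusps' := by
    intro c hc
    rw [Subgroup.IsArithmetic.isCusp_iff_isCusp_SL2Z] at hc
    rw [OnePoint.isBoundedAt_iff_forall_SL2Z hc]
    exact fun γ _ => hf.bdd γ

lemma exists_sub_isBigO (hf : IsGammaTwoForm k f) :
    ∃ c : ℂ, (fun τ => f τ - c) =O[atImInfty] fun τ : ℍ => qParam 2 τ := by
  have hp : (2 : ℝ) ∈ (Gamma 2 : Subgroup (GL (Fin 2) ℝ)).strictPeriods := by
    simp
  have h := exp_decay_sub_atImInfty two_pos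
    (SlashInvariantFormClass.periodic_comp_ofComplex hf.toModularForm hp) hf.holo
    (by simpa using! hf.bdd 1)
  refine ⟨_, h.trans (Asymptotics.isBigO_of_le _ fun τ => ?_)⟩
  rw [Function.Periodic.norm_qParam]
  simp

end IsGammaTwoForm

lemma isGammaTwoForm_e₁ : IsGammaTwoForm 2 e₁ := by
  have hS : e₁ ∣[(2 : ℤ)] ModularGroup.S = -e₂ := (slash_eq_iff _ _ _ _).mpr fun τ => by
    rw [e₁_S_smul, autFactor_S]; simp [zpow_ofNat]
  have hT : e₁ ∣[(2 : ℤ)] ModularGroup.T = e₁ := (slash_eq_iff _ _ _ _).mpr fun τ => by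
    rw [e₁_T_smul, autFactor_T]; simp
  refine .of_cusps mdifferentiable_e₁ (fun γ hγ => (slash_eq_iff _ _ _ _).mpr fun τ => ?_) ?_ ?_ ?_
  · rw [e₁_smul_of_mem_Gamma0, zpow_ofNat]
    rw [Gamma_mem] at hγ
    exact hγ.2.2.1
  · exact tendsto_e₁.isBigO_one ℝ
  · rw [hS]; exact tendsto_e₂.neg.isBigO_one ℝ
  · rw [SlashAction.slash_mul, hT, hS]; exact tendsto_e₂.neg.isBigO_one ℝ

lemma isGammaTwoForm_e₂ : IsGammaTwoForm 2 e₂ := by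
  have hS : e₂ ∣[(2 : ℤ)] ModularGroup.S = -e₁ := (slash_eq_iff _ _ _ _).mpr fun τ => by
    rw [e₂_S_smul, autFactor_S]; simp [zpow_ofNat]
  have hS' : e₁ ∣[(2 : ℤ)] ModularGroup.S = -e₂ := (slash_eq_iff _ _ _ _).mpr fun τ => by
    rw [e₁_S_smul, autFactor_S]; simp [zpow_ofNat]
  have hT : e₂ ∣[(2 : ℤ)] ModularGroup.T = e₁ - e₂ := (slash_eq_iff _ _ _ _).mpr fun τ => by
    rw [e₂_T_smul, autFactor_T]; simp
  refine .of_cusps mdifferentiable_e₂ (fun γ hγ => ?_) ?_ ?_ ?_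
  -- Invariance transfers from `e₁`, since `e₂` is minus its translate by S and Γ(2) is normal.
  · have hn : ModularGroup.S * γ * ModularGroup.S⁻¹ ∈ Gamma 2 := (Gamma_normal 2).conj_mem γ hγ _
    have h2 : e₂ = -(e₁ ∣[(2 : ℤ)] ModularGroup.S) := by rw [hS', neg_neg]
    have h3 := isGammaTwoForm_e₁.slash _ hn
    rw [h2, SlashAction.neg_slash, ← SlashAction.slash_mul]
    nth_rewrite 2 [← h3]
    rw [← SlashAction.slash_mul]
    congr 2
    group
  · exact tendsto_e₂.isBigO_one ℝ
  · rw [hS]; exact tendsto_e₁.neg.isBigO_one ℝ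
  · rw [SlashAction.slash_mul, hT, sub_eq_add_neg, SlashAction.add_slash, SlashAction.neg_slash,
      hS, hS']
    exact (tendsto_e₂.neg.add tendsto_e₁.neg.neg).isBigO_one ℝ

/-- The space of weight two forms of level `Γ(2)`. -/
def weightTwoSpace : Submodule ℂ (ℍ → ℂ) := Submodule.span ℂ {e₁, e₂}

lemma linear_comb_mem_weightTwoSpace (a b : ℂ) : a • e₁ + b • e₂ ∈ weightTwoSpace :=
  add_mem (Submodule.smul_mem _ _ (Submodule.subset_span (by simp)))
    (Submodule.smul_mem _ _ (Submodule.subset_span (by simp)))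

/-- Forms for `Γ(2)` vanishing at the cusp `i∞` are divisible by `2 e₂ - e₁`. -/
lemma IsGammaTwoForm.div {k : ℤ} {F : ℍ → ℂ} (hF : IsGammaTwoForm (k + 2) F)
    (h0 : F =O[atImInfty] fun τ : ℍ => qParam 2 τ) :
    IsGammaTwoForm k (F / ((2 : ℂ) • e₂ - e₁)) := by
  have hb := (isGammaTwoForm_e₂.const_smul 2).sub isGammaTwoForm_e₁
  have hne : ∀ τ, ((2 : ℂ) • e₂ - e₁) τ ≠ 0 := two_mul_e₂_sub_e₁_ne_zero
  have hdiv (γ : SL(2, ℤ)) : (F / ((2 : ℂ) • e₂ - e₁)) ∣[k] γ =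
      (F ∣[k + 2] γ) / (((2 : ℂ) • e₂ - e₁) ∣[(2 : ℤ)] γ) := by
    rw [← div_slash_SL2, add_sub_cancel_right]
  have hbdd (γ : SL(2, ℤ)) (c : ℂ) (hc : c ≠ 0)
      (hlim : Tendsto (((2 : ℂ) • e₂ - e₁) ∣[(2 : ℤ)] γ) atImInfty (𝓝 c)) :
      IsBoundedAtImInfty ((F / ((2 : ℂ) • e₂ - e₁)) ∣[k] γ) := by
    rw [hdiv, div_eq_mul_inv]
    exact (hF.bdd γ).mul ((hlim.inv₀ hc).isBigO_one ℝ)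
  -- At the cusps reached by S and TS the denominator has the nonzero limits -3/2 and 3/2. At i∞ its
  -- simple zero is absorbed by the vanishing of `F`.
  refine .of_cusps ?_ (fun γ hγ => ?_) ?_ (hbdd _ (-(3 / 2)) (by norm_num) ?_)
    (hbdd _ (3 / 2) (by norm_num) ?_)
  · exact UpperHalfPlane.mdifferentiable_iff.mpr
      ((UpperHalfPlane.mdifferentiable_iff.mp hF.holo).div
        (UpperHalfPlane.mdifferentiable_iff.mp hb.holo) fun z _ => hne _)
  · rw [hdiv, hF.slash γ hγ, hb.slash γ hγ]
  · have h1 : (fun τ : ℍ => F τ * (qParam 2 τ)⁻¹) =O[atImInfty] fun _ => (1 : ℝ) := by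
      refine (h0.mul (Asymptotics.isBigO_refl (fun τ : ℍ => (qParam 2 τ)⁻¹) _)).trans
        (Asymptotics.isBigO_of_le _ fun τ => ?_)
      rw [mul_inv_cancel₀ (Function.Periodic.qParam_ne_zero _)]
      simp
    have h2 := (tendsto_two_mul_e₂_sub_e₁_div.inv₀ (by norm_num)).isBigO_one ℝ
    refine (h1.mul h2).congr (fun τ => ?_) (fun τ => mul_one _)
    have := Function.Periodic.qParam_ne_zero (h := 2) (τ : ℂ)
    have := two_mul_e₂_sub_e₁_ne_zero τ
    simp
    field_simp
  · rw [show ((2 : ℂ) • e₂ - e₁) ∣[(2 : ℤ)] ModularGroup.S = fun τ => -(2 * e₁ τ - e₂ τ) from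
      (slash_eq_iff _ _ _ _).mpr fun τ => by
        simp [-ModularGroup.sl_moeb, e₁_S_smul, e₂_S_smul, zpow_ofNat]; ring]
    exact ((tendsto_e₁.const_mul 2).sub tendsto_e₂).neg.trans_eq (by norm_num)
  · rw [show ((2 : ℂ) • e₂ - e₁) ∣[(2 : ℤ)] (ModularGroup.T * ModularGroup.S) =
      fun τ => 2 * e₁ τ - e₂ τ from
      (slash_eq_iff _ _ _ _).mpr fun τ => by
        simp [-ModularGroup.sl_moeb, mul_smul, autFactor_mul, e₁_S_smul, e₂_S_smul, e₁_T_smul,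
          e₂_T_smul, zpow_ofNat]; ring]
    exact ((tendsto_e₁.const_mul 2).sub tendsto_e₂).trans_eq (by norm_num)

/-- The structure theorem for forms of level `Γ(2)`. -/
theorem IsGammaTwoForm.mem_weightTwoSpace_pow (n : ℕ) {f : ℍ → ℂ}
    (hf : IsGammaTwoForm (2 * n) f) : f ∈ weightTwoSpace ^ n := by
  induction n generalizing f with
  | zero =>
    obtain ⟨c, hc⟩ := ModularForm.eq_const_of_weight_zero
      (IsGammaTwoForm.toModularForm (k := 0) (by simpa using hf))
    replace hc : f = Function.const ℍ c := hc
    rw [hc, pow_zero, Submodule.mem_one]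
    exact ⟨c, rfl⟩
  | succ n ih =>
    obtain ⟨c, hc⟩ := hf.exists_sub_isBigO
    -- A weight two form with limit 1 at i∞, as 4/3 · 1 - 2/3 · 1/2 = 1; subtracting c·θ^(n+1)
    -- removes the constant term of `f`.
    set θ : ℍ → ℂ := (4 / 3 : ℂ) • e₁ + (-(2 / 3) : ℂ) • e₂ with hθ
    have hθ' : IsGammaTwoForm (2 * (n + 1 : ℕ)) (θ ^ (n + 1)) := by
      rw [mul_comm]
      exact ((isGammaTwoForm_e₁.const_smul _).add (isGammaTwoForm_e₂.const_smul _)).pow _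
    have hlim : Tendsto (θ ^ (n + 1)) atImInfty (𝓝 1) := by
      have := ((tendsto_e₁.const_mul (4 / 3)).add (tendsto_e₂.const_mul (-(2 / 3)))).pow (n + 1)
      exact this.trans_eq (by norm_num)
    obtain ⟨d, hd⟩ := hθ'.exists_sub_isBigO
    have hd1 : d = 1 := by
      have h0 := hd.trans_tendsto (tendsto_qParam_two.mono_right nhdsWithin_le_nhds)
      have h1 := tendsto_nhds_unique h0 (hlim.sub_const d)
      exact (sub_eq_zero.mp h1.symm).symm
    have hF := hf.sub (hθ'.const_smul c)
    have hF0 : (f - c • θ ^ (n + 1)) =O[atImInfty] fun τ : ℍ => qParam 2 τ :=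
      (hc.sub (hd.const_mul_left c)).congr_left fun τ => by simp [hd1]; ring
    have hg := ih (IsGammaTwoForm.div (by convert hF using 1; push_cast; ring) hF0)
    have hfeq : f = c • θ ^ (n + 1) +
        ((2 : ℂ) • e₂ - e₁) * ((f - c • θ ^ (n + 1)) / ((2 : ℂ) • e₂ - e₁)) := by
      ext τ
      have : 2 * e₂ τ - e₁ τ ≠ 0 := two_mul_e₂_sub_e₁_ne_zero τ
      simp
      field_simp
      ring
    rw [hfeq]
    refine add_mem (Submodule.smul_mem _ _
      (Submodule.pow_mem_pow _ (linear_comb_mem_weightTwoSpace _ _) _)) ?_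
    rw [pow_succ']
    refine Submodule.mul_mem_mul ?_ hg
    simpa [sub_eq_add_neg, add_comm] using linear_comb_mem_weightTwoSpace (-1) 2

/-! ### Separation of variables for functions with finite-dimensional slices. -/

section Separation

/-- A finite-dimensional space of functions has its dual spanned by point evaluations. -/
lemma span_evaluations_eq_top {X : Type*} (W : Submodule ℂ (X → ℂ)) [FiniteDimensional ℂ W] :
    Submodule.span ℂ (Set.range fun x : X => (LinearMap.proj x ∘ₗ W.subtype : Module.Dual ℂ W)) =
      ⊤ := by
  apply Submodule.span_eq_top_of_ne_zero
  intro w hw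
  by_contra! h
  refine hw (Subtype.ext (funext fun x => ?_))
  exact h _ ⟨x, rfl⟩

/-- A function of two variables all of whose partial functions lie in given spaces, the first of
finite dimension, is a sum of products. -/
lemma mem_span_mul_of_slices {X Y : Type*} (W : Submodule ℂ (X → ℂ)) [FiniteDimensional ℂ W]
    (W' : Submodule ℂ (Y → ℂ)) (f : X × Y → ℂ) (h1 : ∀ y, (fun x => f (x, y)) ∈ W)
    (h2 : ∀ x, (fun y => f (x, y)) ∈ W') :
    f ∈ Submodule.span ℂ {F : X × Y → ℂ | ∃ g ∈ W, ∃ h ∈ W', F = fun p => g p.1 * h p.2} := by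
  let b := Module.finBasis ℂ W
  -- A functional on `W` is a combination of evaluations at points x, so applying it to the slices
  -- gives a combination of the functions y ↦ f(x, y), all in `W'`.
  have hcoord (φ : Module.Dual ℂ W) : (fun y => φ ⟨_, h1 y⟩) ∈ W' := by
    have hφ : φ ∈ Submodule.span ℂ (Set.range fun x : X =>
        (LinearMap.proj x ∘ₗ W.subtype : Module.Dual ℂ W)) := by
      rw [span_evaluations_eq_top]; trivial
    induction hφ using Submodule.span_induction with
    | mem φ hφ =>
      obtain ⟨x, rfl⟩ := hφ
      exact h2 x
    | zero => exact W'.zero_mem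
    | add φ ψ _ _ hφ hψ => exact W'.add_mem hφ hψ
    | smul a φ _ hφ => exact W'.smul_mem a hφ
  have hf : f = ∑ i, fun p : X × Y => (b i : X → ℂ) p.1 * b.coord i ⟨_, h1 p.2⟩ := by
    ext ⟨x, y⟩
    have h := congrArg (fun w : W => (w : X → ℂ) x) (b.sum_repr ⟨_, h1 y⟩)
    simp only [Submodule.coe_sum, Submodule.coe_smul, Finset.sum_apply, Pi.smul_apply,
      smul_eq_mul] at h
    rw [Finset.sum_apply, ← h]
    exact Finset.sum_congr rfl fun i _ => mul_comm _ _
  rw [hf]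
  exact sum_mem fun i _ => Submodule.subset_span ⟨b i, (b i).2, _, hcoord (b.coord i), rfl⟩

end Separation

/-! ### Slices of forms for `G`. -/

section Slices

variable {k : ℤ} {f : ℍ × ℍ → ℂ}

lemma mem_G_iff {A : SL(2, ℤ) × SL(2, ℤ)} : A ∈ G ↔
    Matrix.SpecialLinearGroup.map (Int.castRingHom (ZMod 2)) A.1 =
      Matrix.SpecialLinearGroup.map (Int.castRingHom (ZMod 2)) A.2 := Iff.rfl

lemma diag_mem_G (γ : SL(2, ℤ)) : (γ, γ) ∈ G := rfl

lemma fst_mem_G {γ : SL(2, ℤ)} (hγ : γ ∈ Gamma 2) : (γ, 1) ∈ G := by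
  rw [mem_G_iff, map_one]; exact hγ

lemma IsModularForm.smul (hf : IsModularForm k f) {A B : SL(2, ℤ)} (h : (A, B) ∈ G) (τ₁ τ₂ : ℍ) :
    f (A • τ₁, B • τ₂) = autFactor A τ₁ ^ k * autFactor B τ₂ ^ k * f (τ₁, τ₂) :=
  hf.transform _ h τ₁ τ₂

lemma IsModularForm.slice_fst (hf : IsModularForm k f) (τ₂ : ℍ) :
    IsGammaTwoForm k fun τ₁ => f (τ₁, τ₂) where
  holo := by
    rw [UpperHalfPlane.mdifferentiable_iff]
    have h : DifferentiableOn ℂ ((fun p : ℂ × ℂ => f (ofComplex p.1, ofComplex p.2)) ∘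
        fun z : ℂ => (z, (τ₂ : ℂ))) {z : ℂ | 0 < z.im} :=
      hf.holo.comp (by fun_prop) fun z hz => ⟨hz, τ₂.2⟩
    refine h.congr fun z _ => ?_
    simp
  slash γ hγ := (slash_eq_iff _ _ _ _).mpr fun τ => by
    simpa using hf.smul (fst_mem_G hγ) τ τ₂
  -- The hypothesis concerns only i∞. The diagonal element (γ, γ) carries any other cusp there, at
  -- the cost of moving τ₂ to γ⁻¹τ₂.
  bdd γ := by
    obtain ⟨g, hg⟩ := hf.phi₁
    have h := ((hg (γ⁻¹ • τ₂)).const_mul (autFactor γ (γ⁻¹ • τ₂) ^ k)).isBigO_one ℝ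
    refine h.congr_left fun τ => ?_
    have h' := hf.smul (diag_mem_G γ) τ (γ⁻¹ • τ₂)
    rw [smul_inv_smul] at h'
    rw [slash_apply_eq, h', zpow_neg]
    have := zpow_ne_zero k (autFactor_ne_zero γ τ)
    field_simp

lemma IsModularForm.swap (hf : IsModularForm k f) : IsModularForm k (f ∘ Prod.swap) where
  holo := by
    refine hf.holo.comp (f := fun p : ℂ × ℂ => (p.2, p.1)) (by fun_prop) ?_
    exact fun p hp => ⟨hp.2, hp.1⟩
  transform A hA τ₁ τ₂ := by
    have h := hf.transform A.swap (by rw [mem_G_iff] at hA ⊢; exact hA.symm) τ₂ τ₁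
    simp only [Function.comp_apply, Prod.swap_prod_mk, Prod.fst_swap, Prod.snd_swap] at h ⊢
    rw [h]
    ring
  phi₁ := hf.phi₂
  phi₂ := hf.phi₁

lemma IsModularForm.slice_snd (hf : IsModularForm k f) (τ₁ : ℍ) :
    IsGammaTwoForm k fun τ₂ => f (τ₁, τ₂) := hf.swap.slice_fst τ₁

lemma IsModularForm.eq_zero_of_odd (hf : IsModularForm k f) (hk : Odd k) : f = 0 := by
  ext ⟨τ₁, τ₂⟩
  -- (-1, 1) lies in `G`, acts trivially on points and has automorphy factor (-1)^k.
  have h := hf.smul (A := -1) (B := 1) (fst_mem_G (by simp)) τ₁ τ₂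
  simp [autFactor, hk.neg_one_zpow] at h
  exact self_eq_neg.mp h

lemma IsModularForm.eq_zero_of_neg (hf : IsModularForm k f) (hk : k < 0) : f = 0 := by
  ext ⟨τ₁, τ₂⟩
  have h := ModularForm.isZero_of_neg_weight hk (hf.slice_fst τ₂).toModularForm
  exact DFunLike.congr_fun h τ₁

lemma IsModularForm.mem_span {n : ℕ} (hf : IsModularForm (2 * n) f) :
    f ∈ Submodule.span ℂ {F : ℍ × ℍ → ℂ | ∃ g ∈ weightTwoSpace ^ n, ∃ h ∈ weightTwoSpace ^ n,
      F = fun p => g p.1 * h p.2} := by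
  have : FiniteDimensional ℂ (weightTwoSpace ^ n : Submodule ℂ (ℍ → ℂ)) := by
    rw [FiniteDimensional, Module.Finite.iff_fg]
    exact (Submodule.fg_span (by simp)).pow n
  exact mem_span_mul_of_slices _ _ f
    (fun y => (hf.slice_fst y).mem_weightTwoSpace_pow n)
    (fun x => (hf.slice_snd x).mem_weightTwoSpace_pow n)

end Slices

/-! ### Eigenvectors of ST in weight two. -/

section Eigenbasis

/-- A primitive third root of unity. -/
def ω : ℂ := Complex.exp (2 * Real.pi * Complex.I / 3)

lemma ω_isPrimitiveRoot : IsPrimitiveRoot ω 3 := by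
  simpa [ω] using Complex.isPrimitiveRoot_exp 3 (by norm_num)

lemma ω_rel : ω ^ 2 + ω + 1 = 0 := by
  have h := ω_isPrimitiveRoot.geom_sum_eq_zero (by norm_num)
  simp [Finset.sum_range_succ] at h
  linear_combination h

lemma ω_cube : ω ^ 3 = 1 := ω_isPrimitiveRoot.pow_eq_one

/-- The eigenvectors `e₁ + ω e₂`, `e₁ + ω² e₂` of `ST` in the space of weight two forms. -/
def eigU (τ : ℍ) : ℂ := e₁ τ + ω * e₂ τ

/-- The conjugate of `eigU`. -/
def eigV (τ : ℍ) : ℂ := e₁ τ + ω ^ 2 * e₂ τ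

lemma weightTwoSpace_le_span : weightTwoSpace ≤ Submodule.span ℂ {eigU, eigV} := by
  have h1 : ω - 1 ≠ 0 := sub_ne_zero.mpr (ω_isPrimitiveRoot.ne_one (by norm_num))
  have h2 : ω ≠ 0 := ω_isPrimitiveRoot.ne_zero (by norm_num)
  rw [weightTwoSpace, Submodule.span_le]
  rintro _ (rfl | rfl)
  · refine Submodule.mem_span_pair.mpr ⟨(ω - 1)⁻¹ * ω, -(ω - 1)⁻¹, funext fun τ => ?_⟩
    simp only [Pi.add_apply, Pi.smul_apply, smul_eq_mul, eigU, eigV]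
    field_simp
    ring
  · refine Submodule.mem_span_pair.mpr ⟨-((ω - 1) * ω)⁻¹, ((ω - 1) * ω)⁻¹, funext fun τ => ?_⟩
    simp only [Pi.add_apply, Pi.smul_apply, smul_eq_mul, eigU, eigV]
    field_simp
    ring

lemma weightTwoSpace_pow_le (n : ℕ) : weightTwoSpace ^ n ≤
    Submodule.span ℂ {g | ∃ a b : ℕ, a + b = n ∧ g = eigU ^ a * eigV ^ b} := by
  induction n with
  | zero =>
    rw [pow_zero, Submodule.one_eq_span, Submodule.span_le, Set.singleton_subset_iff]
    exact Submodule.subset_span ⟨0, 0, rfl, by simp⟩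
  | succ n ih =>
    rw [pow_succ']
    refine (mul_le_mul' weightTwoSpace_le_span ih).trans ?_
    rw [Submodule.span_mul_span, Submodule.span_le]
    rintro _ ⟨x, hx, _, ⟨a, b, rfl, rfl⟩, rfl⟩
    refine Submodule.subset_span ?_
    rcases hx with rfl | rfl
    · exact ⟨a + 1, b, by ring, by ring⟩
    · exact ⟨a, b + 1, by ring, by ring⟩

lemma eigU_S_smul (τ : ℍ) : eigU (ModularGroup.S • τ) = (τ : ℂ) ^ 2 * (-ω * eigV τ) := by
  rw [eigU, eigV, e₁_S_smul, e₂_S_smul]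
  linear_combination (τ : ℂ) ^ 2 * e₂ τ * ω_cube

lemma eigV_S_smul (τ : ℍ) : eigV (ModularGroup.S • τ) = (τ : ℂ) ^ 2 * (-ω ^ 2 * eigU τ) := by
  rw [eigU, eigV, e₁_S_smul, e₂_S_smul]
  linear_combination (τ : ℂ) ^ 2 * e₂ τ * ω_cube

lemma eigU_ST_smul (τ : ℍ) : eigU ((ModularGroup.S * ModularGroup.T) • τ) =
    autFactor (ModularGroup.S * ModularGroup.T) τ ^ 2 * (ω ^ 2 * eigU τ) := by
  rw [mul_smul, eigU_S_smul, autFactor_mul, autFactor_S, autFactor_T, eigV, eigU, e₁_T_smul,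
    e₂_T_smul]
  linear_combination ((ModularGroup.T • τ : ℍ) : ℂ) ^ 2 * e₁ τ * (-ω_rel - ω_cube)

lemma eigV_ST_smul (τ : ℍ) : eigV ((ModularGroup.S * ModularGroup.T) • τ) =
    autFactor (ModularGroup.S * ModularGroup.T) τ ^ 2 * (ω * eigV τ) := by
  rw [mul_smul, eigV_S_smul, autFactor_mul, autFactor_S, autFactor_T, eigV, eigU, e₁_T_smul,
    e₂_T_smul]
  linear_combination ((ModularGroup.T • τ : ℍ) : ℂ) ^ 2 * e₁ τ * (-ω_rel - ω_cube)

end Eigenbasis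

/-! ### The generators expressed through products of eigenforms. -/

section Bilinear

/-- The products of the eigenforms in the two variables. -/
def prodUU (p : ℍ × ℍ) : ℂ := eigU p.1 * eigU p.2

/-- See `prodUU`. -/
def prodUV (p : ℍ × ℍ) : ℂ := eigU p.1 * eigV p.2

/-- See `prodUU`. -/
def prodVU (p : ℍ × ℍ) : ℂ := eigV p.1 * eigU p.2

/-- See `prodUU`. -/
def prodVV (p : ℍ × ℍ) : ℂ := eigV p.1 * eigV p.2

/-- u³ + v³ splits over the cube roots of unity as (u + v)(ωu + ω²v)(ω²u + ωv), and these are, up to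
sign, the three factors in `eta12_eq_prod`. -/
lemma eigU_cube_add_eigV_cube (τ : ℍ) : eigU τ ^ 3 + eigV τ ^ 3 = -54 * eta12 τ := by
  have h := eta12_eq_prod τ
  have h1 : eigU τ + eigV τ = 2 * e₁ τ - e₂ τ := by
    rw [eigU, eigV]; linear_combination e₂ τ * ω_rel
  have h2 : ω * eigU τ + ω ^ 2 * eigV τ = -(e₁ τ + e₂ τ) := by
    rw [eigU, eigV]
    linear_combination (e₁ τ + e₂ τ) * ω_rel + e₂ τ * ω * ω_cube
  have h3 : ω ^ 2 * eigU τ + ω * eigV τ = 2 * e₂ τ - e₁ τ := by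
    rw [eigU, eigV]
    linear_combination e₁ τ * ω_rel + 2 * e₂ τ * ω_cube
  have h4 : (ω * eigU τ + ω ^ 2 * eigV τ) * (ω ^ 2 * eigU τ + ω * eigV τ) =
      eigU τ ^ 2 - eigU τ * eigV τ + eigV τ ^ 2 := by
    linear_combination (eigU τ ^ 2 + eigV τ ^ 2 + ω * eigU τ * eigV τ) * ω_cube +
      eigU τ * eigV τ * ω_rel
  rw [h2, h3] at h4
  calc eigU τ ^ 3 + eigV τ ^ 3
      = (eigU τ + eigV τ) * (eigU τ ^ 2 - eigU τ * eigV τ + eigV τ ^ 2) := by ring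
    _ = -54 * eta12 τ := by rw [h1, ← h4]; linear_combination h

lemma prodUV_add_prodVU : prodUV + prodVU = (3 / 2 : ℂ) • X₂ := by
  ext p
  simp only [Pi.add_apply, Pi.smul_apply, smul_eq_mul, prodUV, prodVU, X₂, f₁₁, f₁₂, f₂₁, f₂₂,
    eigU, eigV]
  linear_combination (e₁ p.1 * e₂ p.2 + e₂ p.1 * e₁ p.2) * ω_rel + 2 * e₂ p.1 * e₂ p.2 * ω_cube

lemma ω_sq_sub_ω_sq : (ω ^ 2 - ω) ^ 2 = -3 := by
  linear_combination (ω - 2) * ω_cube + ω_rel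

lemma prodUV_sub_prodVU_apply (p : ℍ × ℍ) :
    prodUV p - prodVU p = (ω ^ 2 - ω) * (f₁₂ p - f₂₁ p) := by
  simp only [prodUV, prodVU, f₁₂, f₂₁, eigU, eigV]
  ring

lemma prodUV_sub_prodVU_sq : (prodUV - prodVU) ^ 2 = (-432 : ℂ) • X₄ := by
  ext p
  simp only [Pi.sub_apply, Pi.pow_apply, Pi.smul_apply, smul_eq_mul, prodUV_sub_prodVU_apply, X₄]
  linear_combination (f₁₂ p - f₂₁ p) ^ 2 * ω_sq_sub_ω_sq

lemma cubes_eq_Δ₆ : prodUU ^ 3 + prodVV ^ 3 + prodUV ^ 3 + prodVU ^ 3 = (2916 : ℂ) • Δ₆ := by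
  ext p
  have h : Δ₆ p = eta12 p.1 * eta12 p.2 := rfl
  have h1 := eigU_cube_add_eigV_cube p.1
  have h2 := eigU_cube_add_eigV_cube p.2
  simp only [Pi.add_apply, Pi.pow_apply, Pi.smul_apply, smul_eq_mul, prodUV, prodVU, prodUU,
    prodVV, h]
  linear_combination (eigU p.2 ^ 3 + eigV p.2 ^ 3) * h1 - 54 * eta12 p.1 * h2

/-- UU³ - VV³ splits over the cube roots of unity; its three factors and UV - VU are proportional to
the four factors of `X₈`. -/
lemma sub_mul_sub_eq_X₈ :
    (prodUV - prodVU) * (prodUU ^ 3 - prodVV ^ 3) = (-729 : ℂ) • X₈ := by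
  ext p
  have h1 : prodUU p - prodVV p = (ω - ω ^ 2) * (f₁₂ p + f₂₁ p - f₂₂ p) := by
    simp only [prodUU, prodVV, f₁₂, f₂₁, f₂₂, eigU, eigV]
    linear_combination -ω * e₂ p.1 * e₂ p.2 * ω_cube
  have h2 : prodUU p - ω * prodVV p = (ω - 1) * (f₁₂ p + f₂₁ p - f₁₁ p) := by
    simp only [prodUU, prodVV, f₁₂, f₂₁, f₁₁, eigU, eigV]
    linear_combination
      -(e₁ p.1 * e₂ p.2 + e₂ p.1 * e₁ p.2 + ω ^ 2 * e₂ p.1 * e₂ p.2) * ω_cube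
  have h3 : prodUU p - ω ^ 2 * prodVV p = (1 - ω ^ 2) * (f₁₁ p - f₂₂ p) := by
    simp only [prodUU, prodVV, f₁₁, f₂₂, eigU, eigV]
    linear_combination -(ω * (e₁ p.1 * e₂ p.2 + e₂ p.1 * e₁ p.2) +
      (ω ^ 3 + 1) * e₂ p.1 * e₂ p.2) * ω_cube
  have h4 := prodUV_sub_prodVU_apply p
  have h5 : prodUU p ^ 3 - prodVV p ^ 3 =
      (prodUU p - prodVV p) * (prodUU p - ω * prodVV p) * (prodUU p - ω ^ 2 * prodVV p) := by
    linear_combination (prodUU p ^ 2 * prodVV p - ω * prodUU p * prodVV p ^ 2) * ω_rel +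
      prodVV p ^ 3 * ω_cube
  have h6 : (ω - 1) * (1 - ω ^ 2) = -3 := by linear_combination ω_rel - ω_cube
  have h7 : (ω - ω ^ 2) * (ω - 1) * (1 - ω ^ 2) * (ω ^ 2 - ω) = -9 := by
    linear_combination -(ω - 1) * (1 - ω ^ 2) * ω_sq_sub_ω_sq + 3 * h6
  simp only [Pi.sub_apply, Pi.mul_apply, Pi.pow_apply, Pi.smul_apply, smul_eq_mul]
  rw [h5, h1, h2, h3, h4, X₈]
  linear_combination (f₁₂ p + f₂₁ p - f₂₂ p) * (f₁₂ p + f₂₁ p - f₁₁ p) * (f₁₁ p - f₂₂ p) *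
    (f₁₂ p - f₂₁ p) * h7

lemma prodUU_mul_prodVV : prodUU * prodVV = prodUV * prodVU := by
  ext p
  simp only [Pi.mul_apply, prodUU, prodVV, prodUV, prodVU]
  ring

end Bilinear

/-! ### The invariant algebra in terms of eigenform products. -/

section Hironaka

/-- The algebra of polynomials in `X₂, X₄, Δ₆`, as functions on `ℍ × ℍ`. -/
def polyAlg : Subalgebra ℂ (ℍ × ℍ → ℂ) := (MvPolynomial.aeval ![X₂, X₄, Δ₆]).range

lemma X₂_mem : X₂ ∈ polyAlg := ⟨MvPolynomial.X 0, by simp⟩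

lemma X₄_mem : X₄ ∈ polyAlg := ⟨MvPolynomial.X 1, by simp⟩

lemma Δ₆_mem : Δ₆ ∈ polyAlg := ⟨MvPolynomial.X 2, by simp⟩

/-- The functions `P(X₂, X₄, Δ₆) + X₈ Q(X₂, X₄, Δ₆)`. -/
def hironaka : Submodule ℂ (ℍ × ℍ → ℂ) where
  carrier := {F | ∃ s ∈ polyAlg, ∃ t ∈ polyAlg, F = s + X₈ * t}
  zero_mem' := ⟨0, zero_mem _, 0, zero_mem _, by simp⟩
  add_mem' := by
    rintro _ _ ⟨s, hs, t, ht, rfl⟩ ⟨s', hs', t', ht', rfl⟩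
    exact ⟨s + s', add_mem hs hs', t + t', add_mem ht ht', by ring⟩
  smul_mem' := by
    rintro c _ ⟨s, hs, t, ht, rfl⟩
    exact ⟨c • s, Subalgebra.smul_mem _ hs c, c • t, Subalgebra.smul_mem _ ht c, by
      rw [smul_add, mul_smul_comm]⟩

lemma diff_sq_mem : (prodUV - prodVU) ^ 2 ∈ polyAlg := by
  rw [prodUV_sub_prodVU_sq]
  exact Subalgebra.smul_mem _ X₄_mem _

lemma sum_mem' : prodUV + prodVU ∈ polyAlg := by
  rw [prodUV_add_prodVU]
  exact Subalgebra.smul_mem _ X₂_mem _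

lemma prod_mem' : prodUV * prodVU ∈ polyAlg := by
  have h : prodUV * prodVU =
      (1 / 4 : ℂ) • ((prodUV + prodVU) ^ 2 - (prodUV - prodVU) ^ 2) := by
    ext p
    simp
    ring
  rw [h]
  exact Subalgebra.smul_mem _ (sub_mem (pow_mem sum_mem' 2) diff_sq_mem) _

lemma cubes_sum_mem : prodUU ^ 3 + prodVV ^ 3 ∈ polyAlg := by
  have h : prodUU ^ 3 + prodVV ^ 3 = (2916 : ℂ) • Δ₆ -
      ((prodUV + prodVU) ^ 3 - 3 * (prodUV * prodVU * (prodUV + prodVU))) := by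
    rw [← cubes_eq_Δ₆]; ring
  rw [h]
  exact sub_mem (Subalgebra.smul_mem _ Δ₆_mem _) (sub_mem (pow_mem sum_mem' 3)
    (mul_mem (ofNat_mem _ 3) (mul_mem prod_mem' sum_mem')))

/-- The discriminant identity (A - B)² = (A + B)² - 4AB, together with UU · VV = UV · VU. -/
lemma cubes_diff_sq_mem : (prodUU ^ 3 - prodVV ^ 3) ^ 2 ∈ polyAlg := by
  have h : (prodUU ^ 3 - prodVV ^ 3) ^ 2 = (prodUU ^ 3 + prodVV ^ 3) ^ 2 -
      4 * (prodUV * prodVU) ^ 3 := by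
    rw [← prodUU_mul_prodVV]; ring
  rw [h]
  exact sub_mem (pow_mem cubes_sum_mem 2) (mul_mem (ofNat_mem _ 4) (pow_mem prod_mem' 3))

/-- Pairs of functions that are conjugate under the exchange of the two eigenforms. -/
def conjPairs : Subalgebra ℂ ((ℍ × ℍ → ℂ) × (ℍ × ℍ → ℂ)) where
  carrier := {F | ∃ s₀ ∈ polyAlg, ∃ s₁ ∈ polyAlg, ∃ s₂ ∈ polyAlg, ∃ s₃ ∈ polyAlg,
    F = (s₀ + s₁ * (prodUV - prodVU) + s₂ * (prodUU ^ 3 - prodVV ^ 3) +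
        s₃ * ((prodUV - prodVU) * (prodUU ^ 3 - prodVV ^ 3)),
      s₀ - s₁ * (prodUV - prodVU) - s₂ * (prodUU ^ 3 - prodVV ^ 3) +
        s₃ * ((prodUV - prodVU) * (prodUU ^ 3 - prodVV ^ 3)))}
  algebraMap_mem' c := ⟨algebraMap ℂ _ c, Subalgebra.algebraMap_mem _ c, 0, zero_mem _, 0,
    zero_mem _, 0, zero_mem _, by ext <;> simp⟩
  add_mem' := by
    rintro _ _ ⟨s₀, h₀, s₁, h₁, s₂, h₂, s₃, h₃, rfl⟩ ⟨t₀, k₀, t₁, k₁, t₂, k₂, t₃, k₃, rfl⟩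
    refine ⟨s₀ + t₀, add_mem h₀ k₀, s₁ + t₁, add_mem h₁ k₁, s₂ + t₂, add_mem h₂ k₂, s₃ + t₃,
      add_mem h₃ k₃, ?_⟩
    rw [Prod.mk_add_mk]
    congr 1 <;> ring
  mul_mem' := by
    rintro _ _ ⟨s₀, h₀, s₁, h₁, s₂, h₂, s₃, h₃, rfl⟩ ⟨t₀, k₀, t₁, k₁, t₂, k₂, t₃, k₃, rfl⟩
    -- Both p and q change sign under conjugation and have squares in `polyAlg`, so products of
    -- expressions in 1, p, q, pq reduce to that shape, compatibly with conjugation.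
    have hp := diff_sq_mem
    have hq := cubes_diff_sq_mem
    generalize prodUV - prodVU = p at *
    generalize prodUU ^ 3 - prodVV ^ 3 = q at *
    refine ⟨s₀ * t₀ + s₁ * t₁ * p ^ 2 + s₂ * t₂ * q ^ 2 + s₃ * t₃ * (p ^ 2 * q ^ 2),
      add_mem (add_mem (add_mem (mul_mem h₀ k₀) (mul_mem (mul_mem h₁ k₁) hp))
        (mul_mem (mul_mem h₂ k₂) hq)) (mul_mem (mul_mem h₃ k₃) (mul_mem hp hq)),
      s₀ * t₁ + s₁ * t₀ + (s₂ * t₃ + s₃ * t₂) * q ^ 2,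
      add_mem (add_mem (mul_mem h₀ k₁) (mul_mem h₁ k₀))
        (mul_mem (add_mem (mul_mem h₂ k₃) (mul_mem h₃ k₂)) hq),
      s₀ * t₂ + s₂ * t₀ + (s₁ * t₃ + s₃ * t₁) * p ^ 2,
      add_mem (add_mem (mul_mem h₀ k₂) (mul_mem h₂ k₀))
        (mul_mem (add_mem (mul_mem h₁ k₃) (mul_mem h₃ k₁)) hp),
      s₀ * t₃ + s₃ * t₀ + s₁ * t₂ + s₂ * t₁,
      add_mem (add_mem (add_mem (mul_mem h₀ k₃) (mul_mem h₃ k₀)) (mul_mem h₁ k₂))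
        (mul_mem h₂ k₁), ?_⟩
    rw [Prod.mk_mul_mk]
    congr 1 <;> ring

lemma add_mem_hironaka {F : (ℍ × ℍ → ℂ) × (ℍ × ℍ → ℂ)} (hF : F ∈ conjPairs) :
    F.1 + F.2 ∈ hironaka := by
  obtain ⟨s₀, h₀, s₁, h₁, s₂, h₂, s₃, h₃, rfl⟩ := hF
  -- The p and q terms cancel and the others double: pq = -729 X₈ gives -1458.
  refine ⟨(2 : ℂ) • s₀, Subalgebra.smul_mem _ h₀ _, (-1458 : ℂ) • s₃,
    Subalgebra.smul_mem _ h₃ _, ?_⟩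
  have h := sub_mul_sub_eq_X₈
  generalize prodUV - prodVU = p at *
  generalize prodUU ^ 3 - prodVV ^ 3 = q at *
  simp only [h]
  ext z
  simp
  ring

lemma pairUV_mem : (prodUV, prodVU) ∈ conjPairs := by
  refine ⟨(1 / 2 : ℂ) • (prodUV + prodVU), Subalgebra.smul_mem _ sum_mem' _,
    algebraMap ℂ _ (1 / 2), Subalgebra.algebraMap_mem _ _, 0, zero_mem _, 0, zero_mem _, ?_⟩
  ext p <;> simp <;> ring

lemma pairVU_mem : (prodVU, prodUV) ∈ conjPairs := by
  refine ⟨(1 / 2 : ℂ) • (prodUV + prodVU), Subalgebra.smul_mem _ sum_mem' _,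
    algebraMap ℂ _ (-1 / 2), Subalgebra.algebraMap_mem _ _, 0, zero_mem _, 0, zero_mem _, ?_⟩
  ext p <;> simp <;> ring

lemma pairUU_mem : (prodUU ^ 3, prodVV ^ 3) ∈ conjPairs := by
  refine ⟨(1 / 2 : ℂ) • (prodUU ^ 3 + prodVV ^ 3), Subalgebra.smul_mem _ cubes_sum_mem _,
    0, zero_mem _, algebraMap ℂ _ (1 / 2), Subalgebra.algebraMap_mem _ _, 0, zero_mem _, ?_⟩
  ext p <;> simp <;> ring

lemma pairVV_mem : (prodVV ^ 3, prodUU ^ 3) ∈ conjPairs := by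
  refine ⟨(1 / 2 : ℂ) • (prodUU ^ 3 + prodVV ^ 3), Subalgebra.smul_mem _ cubes_sum_mem _,
    0, zero_mem _, algebraMap ℂ _ (-1 / 2), Subalgebra.algebraMap_mem _ _, 0, zero_mem _, ?_⟩
  ext p <;> simp <;> ring

/-- The monomial `u(τ₁)ᵃ v(τ₁)ᵃ' u(τ₂)ᵇ v(τ₂)ᵇ'`. -/
def eigMonomial (a a' b b' : ℕ) (p : ℍ × ℍ) : ℂ :=
  eigU p.1 ^ a * eigV p.1 ^ a' * (eigU p.2 ^ b * eigV p.2 ^ b')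

/-- If b' ≤ a, the monomial is UV^b' · VU^a' · UU^t with t = a - b', and the congruence amounts to 3
∣ t. The other case has VV in place of UU. -/
lemma eigMonomial_pair_mem {a a' b b' : ℕ} (h : a + a' = b + b')
    (h3 : 3 ∣ 2 * a + a' + 2 * b + b') :
    (eigMonomial a a' b b', eigMonomial a' a b' b) ∈ conjPairs := by
  rcases le_total b' a with hba | hba
  · obtain ⟨t, rfl⟩ := Nat.exists_eq_add_of_le hba
    obtain rfl : b = a' + t := by omega
    obtain ⟨l, rfl⟩ : 3 ∣ t := by omega
    have hm := mul_mem (mul_mem (pow_mem pairUV_mem b') (pow_mem pairVU_mem a'))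
      (pow_mem pairUU_mem l)
    convert hm using 1
    ext p <;> simp [eigMonomial, prodUV, prodVU, prodUU, prodVV] <;> ring
  · obtain ⟨t, rfl⟩ := Nat.exists_eq_add_of_le hba
    obtain rfl : a' = b + t := by omega
    obtain ⟨l, rfl⟩ : 3 ∣ t := by omega
    have hm := mul_mem (mul_mem (pow_mem pairUV_mem a) (pow_mem pairVU_mem b))
      (pow_mem pairVV_mem l)
    convert hm using 1
    ext p <;> simp [eigMonomial, prodUV, prodVU, prodUU, prodVV] <;> ring

end Hironaka

/-! ### Averaging over the diagonal action of S₃. -/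

section Averaging

/-- The diagonal weight `k` slash operator on functions of two variables. -/
def diagSlash (k : ℤ) (γ : SL(2, ℤ)) : (ℍ × ℍ → ℂ) →ₗ[ℂ] (ℍ × ℍ → ℂ) where
  toFun f p := (autFactor γ p.1 * autFactor γ p.2) ^ (-k) * f (γ • p.1, γ • p.2)
  map_add' f g := by ext p; simp only [Pi.add_apply]; ring
  map_smul' c f := by ext p; simp only [Pi.smul_apply, smul_eq_mul, RingHom.id_apply]; ring

lemma diagSlash_eq_iff (k : ℤ) (γ : SL(2, ℤ)) (f g : ℍ × ℍ → ℂ) :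
    diagSlash k γ f = g ↔ ∀ p : ℍ × ℍ, f (γ • p.1, γ • p.2) =
      (autFactor γ p.1 * autFactor γ p.2) ^ k * g p := by
  rw [funext_iff]
  refine forall_congr' fun p => ?_
  rw [diagSlash, LinearMap.coe_mk, AddHom.coe_mk, zpow_neg, inv_mul_eq_iff_eq_mul₀
    (zpow_ne_zero _ (mul_ne_zero (autFactor_ne_zero _ _) (autFactor_ne_zero _ _)))]

lemma IsModularForm.diagSlash_eq {k : ℤ} {f : ℍ × ℍ → ℂ} (hf : IsModularForm k f)
    (γ : SL(2, ℤ)) : diagSlash k γ f = f :=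
  (diagSlash_eq_iff _ _ _ _).mpr fun p => by
    rw [hf.smul (diag_mem_G γ), mul_zpow]

/-- The projection onto the invariants of the diagonal action. -/
def average (k : ℤ) : (ℍ × ℍ → ℂ) →ₗ[ℂ] (ℍ × ℍ → ℂ) :=
  (1 / 6 : ℂ) • ((1 + diagSlash k ModularGroup.S) * (1 + diagSlash k (ModularGroup.S *
    ModularGroup.T) + diagSlash k (ModularGroup.S * ModularGroup.T) ^ 2))

lemma IsModularForm.average_eq {k : ℤ} {f : ℍ × ℍ → ℂ} (hf : IsModularForm k f) :
    average k f = f := by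
  simp only [average, LinearMap.smul_apply, Module.End.mul_apply, LinearMap.add_apply,
    Module.End.one_apply, pow_two, hf.diagSlash_eq, map_add]
  ext p
  simp
  ring

variable {n a a' b b' : ℕ}

lemma diagSlash_S_eigMonomial (h : a + a' = n) (h' : b + b' = n) :
    diagSlash (2 * n) ModularGroup.S (eigMonomial a a' b b') =
      ω ^ (a + 2 * a' + b + 2 * b') • eigMonomial a' a b' b := by
  refine (diagSlash_eq_iff _ _ _ _).mpr fun p => ?_
  have hz : ((2 : ℤ) * (n : ℤ)) = ((2 * n : ℕ) : ℤ) := by push_cast; rfl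
  rw [hz, zpow_natCast]
  simp only [eigMonomial, eigU_S_smul, eigV_S_smul, autFactor_S, Pi.smul_apply, smul_eq_mul]
  -- The signs from S number a + a' + b + b' = 2n.
  have hs : ((-1 : ℂ)) ^ (a + a' + b + b') = 1 := Even.neg_one_pow ⟨n, by omega⟩
  have h1 : ((p.1 : ℂ) * (p.2 : ℂ)) ^ (2 * n) =
      ((p.1 : ℂ) ^ 2) ^ (a + a') * ((p.2 : ℂ) ^ 2) ^ (b + b') := by
    rw [h, h', mul_pow, pow_mul, pow_mul]
  have hn (x : ℂ) : -x = (-1) * x := by ring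
  rw [h1, hn ω, hn (ω ^ 2)]
  generalize (-1 : ℂ) = s at hs
  linear_combination (((p.1 : ℂ) ^ 2) ^ (a + a') * ((p.2 : ℂ) ^ 2) ^ (b + b') *
    (ω ^ (a + 2 * a' + b + 2 * b') *
      (eigU p.1 ^ a' * eigV p.1 ^ a * (eigU p.2 ^ b' * eigV p.2 ^ b)))) * hs

lemma diagSlash_ST_eigMonomial (h : a + a' = n) (h' : b + b' = n) :
    diagSlash (2 * n) (ModularGroup.S * ModularGroup.T) (eigMonomial a a' b b') =
      ω ^ (2 * a + a' + 2 * b + b') • eigMonomial a a' b b' := by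
  refine (diagSlash_eq_iff _ _ _ _).mpr fun p => ?_
  have hz : ((2 : ℤ) * (n : ℤ)) = ((2 * n : ℕ) : ℤ) := by push_cast; rfl
  rw [hz, zpow_natCast]
  simp only [eigMonomial, eigU_ST_smul, eigV_ST_smul, Pi.smul_apply, smul_eq_mul]
  generalize autFactor (ModularGroup.S * ModularGroup.T) p.1 = x
  generalize autFactor (ModularGroup.S * ModularGroup.T) p.2 = y
  have h1 : (x * y) ^ (2 * n) = (x ^ 2) ^ (a + a') * (y ^ 2) ^ (b + b') := by
    rw [h, h', mul_pow, pow_mul, pow_mul]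
  rw [h1]
  ring

lemma ω_pow_of_dvd {m : ℕ} (h : 3 ∣ m) : ω ^ m = 1 := by
  obtain ⟨l, rfl⟩ := h
  rw [pow_mul, ω_cube, one_pow]

lemma one_add_ω_pow_of_not_dvd {m : ℕ} (h : ¬ 3 ∣ m) : 1 + ω ^ m + (ω ^ m) ^ 2 = 0 := by
  have h1 : ω ^ m ≠ 1 := fun h1 => h ((ω_isPrimitiveRoot.pow_eq_one_iff_dvd m).mp h1)
  have h2 : (ω ^ m) ^ 3 = 1 := by rw [← pow_mul, mul_comm, pow_mul, ω_cube, one_pow]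
  apply mul_left_cancel₀ (sub_ne_zero.mpr h1)
  linear_combination h2

/-- With m = 2a + a' + 2b + b', ST has eigenvalue ω^m, so its average is zero unless 3 ∣ m. In that
case the scalar produced by S is ω^(6n - m) = 1, leaving the monomial plus its conjugate. -/
lemma average_eigMonomial_mem (h : a + a' = n) (h' : b + b' = n) :
    average (2 * n) (eigMonomial a a' b b') ∈ hironaka := by
  have hST := diagSlash_ST_eigMonomial h h'
  have hS := diagSlash_S_eigMonomial h h'
  rw [average, LinearMap.smul_apply, Module.End.mul_apply]
  refine Submodule.smul_mem _ _ ?_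
  have h1 : (1 + diagSlash (2 * n) (ModularGroup.S * ModularGroup.T) +
      diagSlash (2 * n) (ModularGroup.S * ModularGroup.T) ^ 2 :
        Module.End ℂ (ℍ × ℍ → ℂ)) (eigMonomial a a' b b') =
      (1 + ω ^ (2 * a + a' + 2 * b + b') + (ω ^ (2 * a + a' + 2 * b + b')) ^ 2) •
        eigMonomial a a' b b' := by
    simp only [LinearMap.add_apply, Module.End.one_apply, pow_two, Module.End.mul_apply, hST,
      map_smul]
    module
  rw [h1, map_smul]
  by_cases h3 : 3 ∣ 2 * a + a' + 2 * b + b'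
  · refine Submodule.smul_mem _ _ ?_
    rw [LinearMap.add_apply, hS, ω_pow_of_dvd (by omega), one_smul]
    exact add_mem_hironaka (eigMonomial_pair_mem (h.trans h'.symm) h3)
  · rw [one_add_ω_pow_of_not_dvd h3, zero_smul]
    exact zero_mem _

/-- Every modular form for `G` is a polynomial in `X₂, X₄, Δ₆` plus `X₈` times another one. -/
theorem IsModularForm.mem_hironaka {k : ℤ} {f : ℍ × ℍ → ℂ} (hf : IsModularForm k f) :
    f ∈ hironaka := by
  rcases k.even_or_odd' with ⟨m, rfl | rfl⟩
  swap
  · rw [hf.eq_zero_of_odd ⟨m, rfl⟩]; exact zero_mem _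
  rcases lt_or_ge m 0 with hm | hm
  · rw [hf.eq_zero_of_neg (by omega)]; exact zero_mem _
  lift m to ℕ using hm with n
  rw [← hf.average_eq]
  suffices h : Submodule.span ℂ {F : ℍ × ℍ → ℂ | ∃ g ∈ weightTwoSpace ^ n,
      ∃ h ∈ weightTwoSpace ^ n, F = fun p => g p.1 * h p.2} ≤
      hironaka.comap (average (2 * n)) from h hf.mem_span
  rw [Submodule.span_le]
  rintro _ ⟨g, hg, h, hh, rfl⟩
  change _ ∈ hironaka.comap (average (2 * n))
  replace hg := weightTwoSpace_pow_le n hg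
  replace hh := weightTwoSpace_pow_le n hh
  induction hg using Submodule.span_induction with
  | zero => convert (hironaka.comap (average (2 * n))).zero_mem using 1; ext p; simp
  | add x y _ _ hx hy => convert add_mem hx hy using 1; ext p; simp [add_mul]
  | smul c x _ hx => convert Submodule.smul_mem _ c hx using 1; ext p; simp [mul_assoc]
  | mem g hg =>
    induction hh using Submodule.span_induction with
    | zero => convert (hironaka.comap (average (2 * n))).zero_mem using 1; ext p; simp
    | add x y _ _ hx hy => convert add_mem hx hy using 1; ext p; simp [mul_add]
    | smul c x _ hx => convert Submodule.smul_mem _ c hx using 1; ext p; simp; ring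
    | mem h hh =>
      obtain ⟨a, a', haa, rfl⟩ := hg
      obtain ⟨b, b', hbb, rfl⟩ := hh
      exact average_eigMonomial_mem haa hbb

end Averaging

/-! ### Infinitely many automorphy factors at a single point. -/

section Scaling

/-- The lower unipotent elements of `Γ(2)`. -/
def lowerUnipotent (N : ℕ) : SL(2, ℤ) := ⟨!![1, 0; 2 * N, 1], by simp⟩

lemma lowerUnipotent_mem (N : ℕ) : lowerUnipotent N ∈ Gamma 2 := by
  have h : (2 : ZMod 2) = 0 := rfl
  rw [Gamma_mem]
  simp [lowerUnipotent, h]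

lemma autFactor_lowerUnipotent (N : ℕ) (τ : ℍ) :
    autFactor (lowerUnipotent N) τ = 2 * N * τ + 1 := by
  simp [autFactor, lowerUnipotent]

lemma injective_autFactor_lowerUnipotent (τ : ℍ) :
    Function.Injective fun N => autFactor (lowerUnipotent N) τ := fun N K h => by
  have h1 : (2 * N * τ + 1 : ℂ) = 2 * K * τ + 1 := by
    simpa only [autFactor_lowerUnipotent] using h
  have h2 : (N : ℂ) = K := by
    have := τ.ne_zero
    apply mul_right_cancel₀ this
    linear_combination h1 / 2
  exact_mod_cast h2

lemma injective_autFactor_sq_lowerUnipotent (τ : ℍ) :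
    Function.Injective fun N => autFactor (lowerUnipotent N) τ ^ 2 := fun N K h => by
  rcases sq_eq_sq_iff_eq_or_eq_neg.mp h with h | h
  · exact injective_autFactor_lowerUnipotent τ h
  -- Opposite factors would have opposite imaginary parts, which forces N + K = 0.
  · rw [autFactor_lowerUnipotent, autFactor_lowerUnipotent] at h
    have h1 := congrArg Complex.im h
    have h2 : ((N : ℝ) + K) * τ.im = 0 := by
      simp at h1
      linarith
    have h3 : (N : ℝ) + K = 0 := (mul_eq_zero.mp h2).resolve_right τ.im_ne_zero
    have h4 : N + K = 0 := by exact_mod_cast h3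
    omega

end Scaling

/-! ### Zariski density of the values of `e₁` and `e₂`. -/

section Density

open MvPolynomial (eval aeval)

lemma algHom_aeval {σ A : Type*} [CommRing A] [Algebra ℂ A] (φ : A →ₐ[ℂ] ℂ) (g : σ → A)
    (Q : MvPolynomial σ ℂ) : φ (aeval g Q) = eval (fun i => φ (g i)) Q := by
  rw [MvPolynomial.comp_aeval_apply, ← MvPolynomial.coe_aeval_eq_eval]
  rfl

lemma eval_aeval {σ ι : Type*} (x : ι → ℂ) (g : σ → MvPolynomial ι ℂ)
    (Q : MvPolynomial σ ℂ) : eval x (aeval g Q) = eval (fun i => eval x (g i)) Q := by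
  have h (P : MvPolynomial ι ℂ) : aeval x P = eval x P := by
    rw [← MvPolynomial.coe_aeval_eq_eval]; rfl
  rw [← h, algHom_aeval]
  simp only [h]

/-- A polynomial vanishing at infinitely many points of a polynomial curve vanishes on it. -/
lemma eval_curve_eq_zero {σ : Type*} (Q : MvPolynomial σ ℂ) (g : σ → Polynomial ℂ) {S : Set ℂ}
    (hS : S.Infinite) (h : ∀ t ∈ S, eval (fun i => (g i).eval t) Q = 0) (t : ℂ) :
    eval (fun i => (g i).eval t) Q = 0 := by
  have key (t : ℂ) : (aeval g Q).eval t = eval (fun i => (g i).eval t) Q :=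
    algHom_aeval (Polynomial.aeval t) g Q
  have h0 : aeval g Q = 0 := Polynomial.eq_zero_of_infinite_isRoot _
    (hS.mono fun t ht => by rw [Set.mem_ofPred_eq, Polynomial.IsRoot, key, h t ht])
  rw [← key, h0, Polynomial.eval_zero]

/-- `e₂/e₁` tends to 1/2 at i∞ but never equals it, because `2e₂ - e₁` has no zero; a finite set
cannot accumulate at a point outside it. -/
lemma infinite_ratios : {r : ℂ | ∃ τ : ℍ, e₁ τ ≠ 0 ∧ r = e₂ τ / e₁ τ}.Infinite := fun hfin => by
  have h1 : Tendsto (fun τ => e₂ τ / e₁ τ) atImInfty (𝓝 (1 / 2)) := by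
    simpa only [div_one] using! tendsto_e₂.div tendsto_e₁ one_ne_zero
  have h2 : (1 / 2 : ℂ) ∉ {r : ℂ | ∃ τ : ℍ, e₁ τ ≠ 0 ∧ r = e₂ τ / e₁ τ} := by
    rintro ⟨τ, h, h'⟩
    rw [eq_div_iff h] at h'
    exact two_mul_e₂_sub_e₁_ne_zero τ (by linear_combination -2 * h')
  have h3 := h1.eventually (hfin.isClosed.isOpen_compl.mem_nhds h2)
  obtain ⟨τ, h4, h5⟩ := (h3.and (tendsto_e₁.eventually_ne one_ne_zero)).exists
  exact h4 ⟨τ, h5, rfl⟩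

lemma eval_eq_zero_of_forall_e₁_e₂ (Q : MvPolynomial (Fin 2) ℂ)
    (h : ∀ τ, eval ![e₁ τ, e₂ τ] Q = 0) (x y : ℂ) : eval ![x, y] Q = 0 := by
  -- Moving τ by Γ(2) rescales (e₁, e₂) by infinitely many squares, so `Q` vanishes on the whole
  -- line through the point; `h2` then uses the infinitely many slopes.
  have h1 (τ : ℍ) (t : ℂ) : eval ![t * e₁ τ, t * e₂ τ] Q = 0 := by
    have := eval_curve_eq_zero Q ![.X * .C (e₁ τ), .X * .C (e₂ τ)]
      (Set.infinite_range_of_injective (injective_autFactor_sq_lowerUnipotent τ)) (by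
        rintro _ ⟨N, rfl⟩
        convert h (lowerUnipotent N • τ) using 3
        have hN := lowerUnipotent_mem N
        have i1 := isGammaTwoForm_e₁.smul_apply hN τ
        have i2 := isGammaTwoForm_e₂.smul_apply hN τ
        rw [i1, i2]
        ext i; fin_cases i <;> simp [zpow_ofNat] <;> ring) t
    convert this using 3
    ext i; fin_cases i <;> simp <;> ring
  have h2 (x r : ℂ) : eval ![x, x * r] Q = 0 := by
    have := eval_curve_eq_zero Q ![.C x, .C x * .X] infinite_ratios (by
        rintro _ ⟨τ, hτ, rfl⟩
        convert h1 τ (x / e₁ τ) using 3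
        ext i; fin_cases i <;> simp <;> field_simp) r
    convert this using 3
    ext i; fin_cases i <;> simp
  -- Slopes reach every point (t, y) with t ≠ 0; the remaining axis follows by polynomiality in t.
  have := eval_curve_eq_zero Q ![.X, .C y] (Set.finite_singleton 0).infinite_compl (by
      intro t ht
      convert h2 t (y / t) using 3
      have ht : t ≠ 0 := ht
      ext i; fin_cases i <;> simp; field_simp) x
  convert this using 3
  ext i; fin_cases i <;> simp

lemma eval_eq_zero_of_forall_e₁_e₂_e₁_e₂ (Q : MvPolynomial (Fin 4) ℂ)
    (h : ∀ τ₁ τ₂, eval ![e₁ τ₁, e₂ τ₁, e₁ τ₂, e₂ τ₂] Q = 0) (x y z w : ℂ) :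
    eval ![x, y, z, w] Q = 0 := by
  have key (x y z w : ℂ) : eval ![x, y] (aeval ![.X 0, .X 1, .C z, .C w] Q) =
      eval ![x, y, z, w] Q := by
    rw [eval_aeval]
    congr 2
    ext i; fin_cases i <;> simp
  have key' (x y z w : ℂ) : eval ![z, w] (aeval ![.C x, .C y, .X 0, .X 1] Q) =
      eval ![x, y, z, w] Q := by
    rw [eval_aeval]
    congr 2
    ext i; fin_cases i <;> simp
  rw [← key']
  refine eval_eq_zero_of_forall_e₁_e₂ _ (fun τ₂ => ?_) z w
  rw [key', ← key]
  refine eval_eq_zero_of_forall_e₁_e₂ _ (fun τ₁ => ?_) x y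
  rw [key, h]

end Density

/-! ### Algebraic independence of `X₂`, `X₄`, `Δ₆`. -/

section Independence

open MvPolynomial (eval aeval)

/-- The polynomials in `(e₁(τ₁), e₂(τ₁), e₁(τ₂), e₂(τ₂))` giving `X₂, X₄, Δ₆`. -/
def generatorPoly {A : Type*} [CommRing A] [Algebra ℂ A] (a b c d : A) : Fin 3 → A :=
  ![(4 / 3 : ℂ) • (a * c + b * d) - (2 / 3 : ℂ) • (a * d + b * c),
    (1 / 144 : ℂ) • (a * d - b * c) ^ 2,
    (1 / 2916 : ℂ) • ((2 * b - a) * (2 * a - b) * (a + b) * ((2 * d - c) * (2 * c - d) * (c + d)))]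

lemma generatorPoly_e (τ₁ τ₂ : ℍ) : generatorPoly (e₁ τ₁) (e₂ τ₁) (e₁ τ₂) (e₂ τ₂) =
    fun i => (![X₂, X₄, Δ₆] : Fin 3 → ℍ × ℍ → ℂ) i (τ₁, τ₂) := by
  ext i
  fin_cases i
  · simp [generatorPoly, X₂, f₁₁, f₁₂, f₂₁, f₂₂]
  · simp [generatorPoly, X₄, f₁₂, f₂₁]
  · have h : Δ₆ (τ₁, τ₂) = eta12 τ₁ * eta12 τ₂ := rfl
    simp [generatorPoly, h, ← eta12_eq_prod]
    ring

lemma map_generatorPoly {A B : Type*} [CommRing A] [Algebra ℂ A] [CommRing B] [Algebra ℂ B]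
    (φ : A →ₐ[ℂ] B) (a b c d : A) (i : Fin 3) :
    φ (generatorPoly a b c d i) = generatorPoly (φ a) (φ b) (φ c) (φ d) i := by
  fin_cases i
  · simp [generatorPoly]
  · simp [generatorPoly]
  · simp [generatorPoly, map_ofNat]

lemma eval_generatorPoly_eq_zero {P : MvPolynomial (Fin 3) ℂ} (hP : aeval ![X₂, X₄, Δ₆] P = 0)
    (a b c d : ℂ) : eval (generatorPoly a b c d) P = 0 := by
  have key (a b c d : ℂ) : eval ![a, b, c, d]
      (aeval (generatorPoly (MvPolynomial.X 0) (.X 1) (.X 2) (.X 3)) P) =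
      eval (generatorPoly a b c d) P := by
    rw [eval_aeval]
    congr 2
    ext i
    rw [← MvPolynomial.coe_aeval_eq_eval]
    exact (map_generatorPoly (aeval ![a, b, c, d]) _ _ _ _ i).trans (by simp)
  rw [← key]
  refine eval_eq_zero_of_forall_e₁_e₂_e₁_e₂ _ (fun τ₁ τ₂ => ?_) a b c d
  rw [key, generatorPoly_e]
  exact (algHom_aeval (Pi.evalAlgHom ℂ (fun _ : ℍ × ℍ => ℂ) (τ₁, τ₂)) _ P).symm.trans
    (congrFun hP (τ₁, τ₂))

lemma cube_add_cube_eq (a b : ℂ) : (a + ω * b) ^ 3 + (a + ω ^ 2 * b) ^ 3 =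
    -((2 * b - a) * (2 * a - b) * (a + b)) := by
  linear_combination (3 * a ^ 2 * b + 3 * a * b ^ 2) * ω_rel +
    (3 * a * b ^ 2 * ω + b ^ 3 * (2 + ω ^ 3)) * ω_cube

/-- In eigenform coordinates one prescribes B = u₁v₂ and C = v₁u₂ through their sum and squared
difference. Normalising v₁ = 1, u₂ = C, v₂ = D, u₁ = B/D, the last equation becomes quadratic in D³
with constant term (BC)³. The hypothesis says BC ≠ 0, so D ≠ 0. -/
lemma exists_generatorPoly_eq (x : Fin 3 → ℂ) (hx : 9 / 4 * x 0 ^ 2 + 432 * x 1 ≠ 0) :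
    ∃ a b c d : ℂ, generatorPoly a b c d = x := by
  obtain ⟨s, hs⟩ := IsAlgClosed.exists_pow_nat_eq (-432 * x 1) two_pos
  obtain ⟨B, hB⟩ : ∃ B, B = (3 / 2 * x 0 + s) / 2 := ⟨_, rfl⟩
  obtain ⟨C, hC⟩ : ∃ C, C = (3 / 2 * x 0 - s) / 2 := ⟨_, rfl⟩
  have hm : B * C ≠ 0 := fun h => hx (by rw [hB, hC] at h; linear_combination 4 * h + hs)
  obtain ⟨w, hw⟩ : ∃ w, w = 2916 * x 2 - (B ^ 3 + C ^ 3) := ⟨_, rfl⟩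
  obtain ⟨r, hr⟩ := IsAlgClosed.exists_pow_nat_eq (w ^ 2 - 4 * (B * C) ^ 3) two_pos
  obtain ⟨D, hD⟩ := IsAlgClosed.exists_pow_nat_eq ((w + r) / 2) three_pos
  have hq : (D ^ 3) ^ 2 - w * D ^ 3 + (B * C) ^ 3 = 0 := by
    rw [hD]; linear_combination hr / 4
  have hD0 : D ≠ 0 := fun h => pow_ne_zero 3 hm (by simpa [h] using hq)
  have hω : ω - ω ^ 2 ≠ 0 := fun h => by
    have := ω_sq_sub_ω_sq
    rw [show (ω ^ 2 - ω) ^ 2 = (ω - ω ^ 2) ^ 2 by ring, h] at this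
    norm_num at this
  have key (u v : ℂ) : ∃ a b : ℂ, a + ω * b = u ∧ a + ω ^ 2 * b = v := by
    refine ⟨u - ω * ((u - v) / (ω - ω ^ 2)), (u - v) / (ω - ω ^ 2), by ring, ?_⟩
    linear_combination -(div_mul_cancel₀ (u - v) hω)
  obtain ⟨a, b, hu, hv⟩ := key (B / D) 1
  obtain ⟨c, d, hu', hv'⟩ := key C D
  refine ⟨a, b, c, d, ?_⟩
  have h1 : (a + ω * b) * (c + ω ^ 2 * d) = B := by rw [hu, hv']; field_simp
  have h2 : (a + ω ^ 2 * b) * (c + ω * d) = C := by rw [hv, hu', one_mul]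
  have h3 : ((a + ω * b) ^ 3 + (a + ω ^ 2 * b) ^ 3) * ((c + ω * d) ^ 3 + (c + ω ^ 2 * d) ^ 3) =
      2916 * x 2 := by
    rw [hu, hv, hu', hv']
    field_simp
    linear_combination hq + D ^ 3 * hw
  rw [cube_add_cube_eq, cube_add_cube_eq] at h3
  ext i
  fin_cases i
  · simp only [generatorPoly, smul_eq_mul, Fin.zero_eta, Matrix.cons_val_zero]
    linear_combination (2 / 3) * (h1 + h2 - (a * d + b * c) * ω_rel - 2 * b * d * ω_cube +
      hB + hC)
  · have h4 : (ω ^ 2 - ω) * (a * d - b * c) = s := by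
      linear_combination h1 - h2 + hB - hC
    simp only [generatorPoly, smul_eq_mul, Fin.mk_one, Matrix.cons_val_one, Matrix.cons_val_zero]
    rw [← h4] at hs
    linear_combination (-1 / 432) * hs + (a * d - b * c) ^ 2 / 432 * ω_sq_sub_ω_sq
  · simp [generatorPoly]
    linear_combination h3 / 2916

/-- `X₂, X₄, Δ₆` are algebraically independent. -/
theorem aeval_injective : Function.Injective
    (aeval ![X₂, X₄, Δ₆] : MvPolynomial (Fin 3) ℂ →ₐ[ℂ] (ℍ × ℍ → ℂ)) := by
  rw [injective_iff_map_eq_zero]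
  intro P hP
  let D : MvPolynomial (Fin 3) ℂ := .C (9 / 4) * .X 0 ^ 2 + .C 432 * .X 1
  have hD (x : Fin 3 → ℂ) : eval x D = 9 / 4 * x 0 ^ 2 + 432 * x 1 := by simp [D]
  -- `P` vanishes wherever `D` does not, so the product vanishes at every point.
  have h : P * D = 0 := MvPolynomial.funext fun x => by
    rw [map_mul, map_zero, hD]
    by_cases hx : 9 / 4 * x 0 ^ 2 + 432 * x 1 = 0
    · rw [hx, mul_zero]
    · obtain ⟨a, b, c, d, rfl⟩ := exists_generatorPoly_eq x hx
      rw [eval_generatorPoly_eq_zero hP, zero_mul]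
  refine (mul_eq_zero.mp h).resolve_right fun hD0 => ?_
  have := hD ![1, 0, 0]
  rw [hD0] at this
  norm_num at this

end Independence

/-! ### From the graded ring to functions. -/

section Evaluation

/-- The sum of the homogeneous components of an element of `M_*(G)`, as a function. -/
def toFunction : MRing →ₐ[ℂ] (ℍ × ℍ → ℂ) := DirectSum.coeAlgHom M

lemma toFunction_of (k : ℤ) (f : M k) : toFunction (DirectSum.of (fun k : ℤ => M k) k f) = f :=
  DirectSum.coeAlgHom_of M k f

open scoped Classical in
lemma toFunction_apply (F : MRing) (p : ℍ × ℍ) :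
    toFunction F p = ∑ k ∈ DFinsupp.support F, (F k : ℍ × ℍ → ℂ) p := by
  have h : toFunction F = ∑ k ∈ DFinsupp.support F, (F k : ℍ × ℍ → ℂ) := by
    conv_lhs => rw [← DirectSum.sum_support_of F]
    rw [map_sum]
    exact Finset.sum_congr rfl fun k _ => toFunction_of k _
  rw [h, Finset.sum_apply]

open scoped Classical in
lemma nonneg_of_mem_support {F : MRing} {k : ℤ} (hk : k ∈ DFinsupp.support F) : 0 ≤ k := by
  by_contra! h
  exact (DFinsupp.mem_support_iff.mp hk) (Subtype.ext (IsModularForm.eq_zero_of_neg (F k).2 h))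

/-- Modular forms of different weights are linearly independent. -/
theorem toFunction_injective : Function.Injective toFunction := by
  classical
  rw [injective_iff_map_eq_zero]
  intro F hF
  ext k p
  by_cases hk : k ∈ DFinsupp.support F
  swap
  · rw [DFinsupp.notMem_support_iff.mp hk]; rfl
  -- At the automorphy factor j of a lower unipotent γ, `Q` takes the value ∑ jᵏ F_k(p) = ∑ F_k(γp₁,
  -- p₂) = 0. Nonnegative weights make this a polynomial in j.
  let Q : Polynomial ℂ :=
    ∑ k ∈ DFinsupp.support F, Polynomial.monomial k.toNat ((F k : ℍ × ℍ → ℂ) p)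
  have hQ : Q = 0 := by
    refine Polynomial.eq_zero_of_infinite_isRoot _ ((Set.infinite_range_of_injective
      (injective_autFactor_lowerUnipotent p.1)).mono ?_)
    rintro _ ⟨N, rfl⟩
    have h := congrFun hF (lowerUnipotent N • p.1, p.2)
    rw [toFunction_apply] at h
    rw [Set.mem_ofPred_eq, Polynomial.IsRoot, Polynomial.eval_finsetSum]
    refine (Finset.sum_congr rfl fun k hk => ?_).trans h
    have h1 := IsGammaTwoForm.smul_apply (IsModularForm.slice_fst (F k).2 p.2)
      (lowerUnipotent_mem N) p.1
    rw [Polynomial.eval_monomial, h1, mul_comm]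
    congr 1
    rw [← zpow_natCast, Int.toNat_of_nonneg (nonneg_of_mem_support hk)]
  have h := congrArg (fun Q => Polynomial.coeff Q k.toNat) hQ
  simp only [Q, Polynomial.finsetSum_coeff, Polynomial.coeff_zero] at h
  rw [Finset.sum_eq_single_of_mem k hk, Polynomial.coeff_monomial, if_pos rfl] at h
  · exact h
  · intro l hl hlk
    rw [Polynomial.coeff_monomial, if_neg]
    have := nonneg_of_mem_support hl
    have := nonneg_of_mem_support hk
    omega

end Evaluation

/-! ### Criteria for modularity. -/

section Membership

variable {k : ℤ}

/-- A form for `Γ(2)` invariant under `T` is a modular form of level `Γ₀(2)`. -/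
lemma IsGammaTwoForm.exists_gamma0TwoForm {f : ℍ → ℂ} (hf : IsGammaTwoForm k f)
    (hT : ∀ τ, f (ModularGroup.T • τ) = f τ) : ∃ g : Gamma0TwoForm k, ⇑g = f := by
  have hT' : f ∣[k] ModularGroup.T = f := (slash_eq_iff _ _ _ _).mpr fun τ => by
    rw [hT, autFactor_T, one_zpow, one_mul]
  refine ⟨{ toFun := f, slash_action_eq' := ?_, holo' := hf.holo, bdd_at_cusps' := ?_ }, rfl⟩
  · rintro _ ⟨γ, hγ, rfl⟩
    -- Modulo 2 the group Γ₀(2) becomes {1, T}, hence Γ₀(2) = Γ(2) ∪ Γ(2)T.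
    have key : ∀ A : Matrix (Fin 2) (Fin 2) (ZMod 2), A.det = 1 → A 1 0 = 0 →
        A = 1 ∨ A = !![1, 1; 0, 1] := by decide
    let red := Matrix.SpecialLinearGroup.map (n := Fin 2) (Int.castRingHom (ZMod 2))
    rcases key (red γ).1 (red γ).2 (Gamma0_mem.mp hγ) with h | h
    · exact hf.slash γ (Gamma_mem'.mpr (Subtype.ext h))
    · have hδ : γ * ModularGroup.T⁻¹ ∈ Gamma 2 := by
        rw [Gamma_mem', map_mul, map_inv, mul_inv_eq_one]
        exact Subtype.ext (h.trans (by decide))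
      have h1 := hf.slash _ hδ
      have h2 : f ∣[k] (γ * ModularGroup.T⁻¹ * ModularGroup.T) = f := by
        rw [SlashAction.slash_mul, h1, hT']
      rwa [inv_mul_cancel_right] at h2
  · intro c hc
    rw [Subgroup.IsArithmetic.isCusp_iff_isCusp_SL2Z] at hc
    rw [OnePoint.isBoundedAt_iff_forall_SL2Z hc]
    exact fun γ _ => hf.bdd γ

lemma smul_diag_of_generators {f : ℍ × ℍ → ℂ}
    (hS : ∀ τ₁ τ₂ : ℍ, f (ModularGroup.S • τ₁, ModularGroup.S • τ₂) =
      (τ₁ * τ₂ : ℂ) ^ k * f (τ₁, τ₂))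
    (hT : ∀ τ₁ τ₂ : ℍ, f (ModularGroup.T • τ₁, ModularGroup.T • τ₂) = f (τ₁, τ₂))
    (γ : SL(2, ℤ)) (τ₁ τ₂ : ℍ) :
    f (γ • τ₁, γ • τ₂) = (autFactor γ τ₁ * autFactor γ τ₂) ^ k * f (τ₁, τ₂) := by
  have hγ : γ ∈ Subgroup.closure {ModularGroup.S, ModularGroup.T} := by
    rw [SpecialLinearGroup.SL2Z_generators]; trivial
  induction hγ using Subgroup.closure_induction generalizing τ₁ τ₂ with
  | mem γ hγ =>
    rcases hγ with rfl | rfl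
    · rw [hS, autFactor_S, autFactor_S]
    · rw [hT, autFactor_T, autFactor_T, one_mul, one_zpow, one_mul]
  | one => simp
  | mul A B _ _ hA hB =>
    rw [mul_smul, mul_smul, hA, hB, autFactor_mul, autFactor_mul, ← mul_assoc, ← mul_zpow]
    congr 2
    ring
  | inv A _ hA =>
    have h := hA (A⁻¹ • τ₁) (A⁻¹ • τ₂)
    have h1 (τ : ℍ) : autFactor A (A⁻¹ • τ) * autFactor A⁻¹ τ = 1 := by
      rw [← autFactor_mul, mul_inv_cancel]; simp
    rw [smul_inv_smul, smul_inv_smul] at h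
    rw [h, ← mul_assoc, ← mul_zpow, mul_mul_mul_comm, mul_comm (autFactor A⁻¹ τ₁),
      mul_comm (autFactor A⁻¹ τ₂), h1, h1, one_mul, one_zpow, one_mul]

/-- A criterion for (anti)symmetric functions to be modular forms for `G`. -/
lemma IsModularForm.of_generators {f : ℍ × ℍ → ℂ} {g : ℍ → ℂ} (c : ℂ)
    (holo : DifferentiableOn ℂ (fun p : ℂ × ℂ => f (ofComplex p.1, ofComplex p.2))
      {p | 0 < p.1.im ∧ 0 < p.2.im})
    (hΓ : ∀ γ ∈ Gamma 2, ∀ τ₁ τ₂ : ℍ, f (γ • τ₁, τ₂) = autFactor γ τ₁ ^ k * f (τ₁, τ₂))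
    (hS : ∀ τ₁ τ₂ : ℍ, f (ModularGroup.S • τ₁, ModularGroup.S • τ₂) =
      (τ₁ * τ₂ : ℂ) ^ k * f (τ₁, τ₂))
    (hT : ∀ τ₁ τ₂ : ℍ, f (ModularGroup.T • τ₁, ModularGroup.T • τ₂) = f (τ₁, τ₂))
    (hswap : ∀ τ₁ τ₂ : ℍ, f (τ₂, τ₁) = c * f (τ₁, τ₂))
    (hg : IsGammaTwoForm k g) (hgT : ∀ τ, g (ModularGroup.T • τ) = g τ)
    (hlim : ∀ τ, Tendsto (fun z => f (z, τ)) atImInfty (𝓝 (g τ))) : IsModularForm k f where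
  holo := holo
  transform := by
    rintro ⟨A, B⟩ hAB τ₁ τ₂
    change f (A • τ₁, B • τ₂) = autFactor A τ₁ ^ k * autFactor B τ₂ ^ k * f (τ₁, τ₂)
    -- (A, B) = (AB⁻¹, 1)(B, B), so Γ(2) in the first variable and the diagonal generate `G`.
    have hδ : A * B⁻¹ ∈ Gamma 2 := by
      rw [Gamma_mem', map_mul, map_inv, mul_inv_eq_one]; exact hAB
    have h := hΓ _ hδ (B • τ₁) (B • τ₂)
    rw [← mul_smul, inv_mul_cancel_right, smul_diag_of_generators hS hT B, mul_zpow] at h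
    have h1 := autFactor_mul (A * B⁻¹) B τ₁
    rw [inv_mul_cancel_right] at h1
    rw [h, h1, mul_zpow]
    ring
  phi₁ := by
    obtain ⟨g', rfl⟩ := hg.exists_gamma0TwoForm hgT
    exact ⟨g', hlim⟩
  phi₂ := by
    obtain ⟨g', rfl⟩ := hg.exists_gamma0TwoForm hgT
    exact ⟨c • g', fun τ => ((hlim τ).const_mul c).congr fun z => (hswap z τ).symm⟩

end Membership

/-! ### Modularity of the four generators and the relation for `X₈²`. -/

section Generators

lemma differentiableOn_e {U : Set (ℂ × ℂ)} (hU : U = {p | 0 < p.1.im ∧ 0 < p.2.im}) :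
    DifferentiableOn ℂ (fun p : ℂ × ℂ => e₁ (ofComplex p.1)) U ∧
    DifferentiableOn ℂ (fun p : ℂ × ℂ => e₂ (ofComplex p.1)) U ∧
    DifferentiableOn ℂ (fun p : ℂ × ℂ => e₁ (ofComplex p.2)) U ∧
    DifferentiableOn ℂ (fun p : ℂ × ℂ => e₂ (ofComplex p.2)) U := by
  subst hU
  have h1 := UpperHalfPlane.mdifferentiable_iff.mp mdifferentiable_e₁
  have h2 := UpperHalfPlane.mdifferentiable_iff.mp mdifferentiable_e₂
  exact ⟨h1.comp differentiableOn_fst fun p hp => hp.1,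
    h2.comp differentiableOn_fst fun p hp => hp.1,
    h1.comp differentiableOn_snd fun p hp => hp.2, h2.comp differentiableOn_snd fun p hp => hp.2⟩

lemma e₁_Gamma_two_smul {γ : SL(2, ℤ)} (hγ : γ ∈ Gamma 2) (τ : ℍ) :
    e₁ (γ • τ) = autFactor γ τ ^ 2 * e₁ τ := by
  simpa only [zpow_ofNat] using isGammaTwoForm_e₁.smul_apply hγ τ

lemma e₂_Gamma_two_smul {γ : SL(2, ℤ)} (hγ : γ ∈ Gamma 2) (τ : ℍ) :
    e₂ (γ • τ) = autFactor γ τ ^ 2 * e₂ τ := by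
  simpa only [zpow_ofNat] using isGammaTwoForm_e₂.smul_apply hγ τ

lemma tendsto_of_continuous_e {F : ℂ × ℂ → ℂ} (hF : Continuous F) {f : ℍ → ℂ} {l : ℂ}
    (hf : ∀ z, f z = F (e₁ z, e₂ z)) (hl : l = F (1, 1 / 2)) : Tendsto f atImInfty (𝓝 l) := by
  rw [funext hf, hl]
  exact (hF.tendsto _).comp (tendsto_e₁.prodMk_nhds tendsto_e₂)

lemma isModularForm_X₂ : IsModularForm 2 X₂ := by
  refine .of_generators (g := e₁) 1 ?_ (fun γ hγ τ₁ τ₂ => ?_) (fun τ₁ τ₂ => ?_)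
    (fun τ₁ τ₂ => ?_) (fun τ₁ τ₂ => ?_) isGammaTwoForm_e₁ e₁_T_smul (fun τ => ?_)
  · obtain ⟨h1, h2, h3, h4⟩ := differentiableOn_e rfl
    have key : ∀ {a b c d : ℂ × ℂ → ℂ} {U : Set (ℂ × ℂ)}, DifferentiableOn ℂ a U →
        DifferentiableOn ℂ b U → DifferentiableOn ℂ c U → DifferentiableOn ℂ d U →
        DifferentiableOn ℂ (fun p => 4 / 3 * (a p * c p + b p * d p) -
          2 / 3 * (a p * d p + b p * c p)) U := by
      intros; fun_prop
    exact key h1 h2 h3 h4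
  · simp only [X₂, f₁₁, f₁₂, f₂₁, f₂₂, e₁_Gamma_two_smul hγ, e₂_Gamma_two_smul hγ, zpow_ofNat]
    ring
  · simp only [X₂, f₁₁, f₁₂, f₂₁, f₂₂, e₁_S_smul, e₂_S_smul, zpow_ofNat]
    ring
  · simp only [X₂, f₁₁, f₁₂, f₂₁, f₂₂, e₁_T_smul, e₂_T_smul]
    ring
  · simp only [X₂, f₁₁, f₁₂, f₂₁, f₂₂]
    ring
  · have key : Continuous fun p : ℂ × ℂ => 4 / 3 * (p.1 * e₁ τ + p.2 * e₂ τ) -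
        2 / 3 * (p.1 * e₂ τ + p.2 * e₁ τ) := by fun_prop
    refine tendsto_of_continuous_e key (fun z => rfl) ?_
    ring

lemma isModularForm_X₄ : IsModularForm 4 X₄ := by
  have hb := (isGammaTwoForm_e₂.const_smul 2).sub isGammaTwoForm_e₁
  -- The boundary form comes from putting (e₁, e₂) = (1, 1/2) in the first variable: (e₂ -
  -- e₁/2)²/144.
  refine .of_generators (g := (1 / 576 : ℂ) • (((2 : ℂ) • e₂ - e₁) * ((2 : ℂ) • e₂ - e₁))) 1 ?_
    (fun γ hγ τ₁ τ₂ => ?_) (fun τ₁ τ₂ => ?_) (fun τ₁ τ₂ => ?_) (fun τ₁ τ₂ => ?_)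
    ((hb.mul hb).const_smul _) (fun τ => ?_) (fun τ => ?_)
  · obtain ⟨h1, h2, h3, h4⟩ := differentiableOn_e rfl
    have key : ∀ {a b c d : ℂ × ℂ → ℂ} {U : Set (ℂ × ℂ)}, DifferentiableOn ℂ a U →
        DifferentiableOn ℂ b U → DifferentiableOn ℂ c U → DifferentiableOn ℂ d U →
        DifferentiableOn ℂ (fun p => 1 / 144 * (a p * d p - b p * c p) ^ 2) U := by
      intros; fun_prop
    exact key h1 h2 h3 h4
  · simp only [X₄, f₁₂, f₂₁, e₁_Gamma_two_smul hγ, e₂_Gamma_two_smul hγ, zpow_ofNat]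
    ring
  · simp only [X₄, f₁₂, f₂₁, e₁_S_smul, e₂_S_smul, zpow_ofNat]
    ring
  · simp only [X₄, f₁₂, f₂₁, e₁_T_smul, e₂_T_smul]
    ring
  · simp only [X₄, f₁₂, f₂₁]
    ring
  · simp only [Pi.smul_apply, Pi.mul_apply, Pi.sub_apply, smul_eq_mul, e₁_T_smul, e₂_T_smul]
    ring
  · have key : Continuous fun p : ℂ × ℂ => 1 / 144 * (p.1 * e₂ τ - p.2 * e₁ τ) ^ 2 := by fun_prop
    refine tendsto_of_continuous_e key (fun z => rfl) ?_
    simp only [Pi.smul_apply, Pi.mul_apply, Pi.sub_apply, smul_eq_mul]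
    ring

lemma Δ₆_eq (τ₁ τ₂ : ℍ) : Δ₆ (τ₁, τ₂) =
    1 / 2916 * ((2 * e₂ τ₁ - e₁ τ₁) * (2 * e₁ τ₁ - e₂ τ₁) * (e₁ τ₁ + e₂ τ₁) *
      ((2 * e₂ τ₂ - e₁ τ₂) * (2 * e₁ τ₂ - e₂ τ₂) * (e₁ τ₂ + e₂ τ₂))) := by
  have h : Δ₆ (τ₁, τ₂) = eta12 τ₁ * eta12 τ₂ := rfl
  rw [h, ← eta12_eq_prod, ← eta12_eq_prod]
  ring

lemma isModularForm_Δ₆ : IsModularForm 6 Δ₆ := by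
  refine .of_generators (g := 0) 1 ?_ (fun γ hγ τ₁ τ₂ => ?_) (fun τ₁ τ₂ => ?_)
    (fun τ₁ τ₂ => ?_) (fun τ₁ τ₂ => ?_) ?_ (fun τ => rfl) (fun τ => ?_)
  · obtain ⟨h1, h2, h3, h4⟩ := differentiableOn_e rfl
    have key : ∀ {a b c d : ℂ × ℂ → ℂ} {U : Set (ℂ × ℂ)}, DifferentiableOn ℂ a U →
        DifferentiableOn ℂ b U → DifferentiableOn ℂ c U → DifferentiableOn ℂ d U →
        DifferentiableOn ℂ (fun p => 1 / 2916 * ((2 * b p - a p) * (2 * a p - b p) * (a p + b p) *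
          ((2 * d p - c p) * (2 * c p - d p) * (c p + d p)))) U := by
      intros; fun_prop
    simp only [Δ₆_eq]
    exact key h1 h2 h3 h4
  · simp only [Δ₆_eq, e₁_Gamma_two_smul hγ, e₂_Gamma_two_smul hγ, zpow_ofNat]
    ring
  · simp only [Δ₆_eq, e₁_S_smul, e₂_S_smul, zpow_ofNat]
    ring
  · simp only [Δ₆_eq, e₁_T_smul, e₂_T_smul]
    ring
  · simp only [Δ₆_eq]
    ring
  · simpa using isGammaTwoForm_e₁.pow 3 |>.const_smul 0
  · have key : Continuous fun p : ℂ × ℂ => 1 / 2916 * ((2 * p.2 - p.1) * (2 * p.1 - p.2) *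
        (p.1 + p.2) * ((2 * e₂ τ - e₁ τ) * (2 * e₁ τ - e₂ τ) * (e₁ τ + e₂ τ))) := by fun_prop
    refine tendsto_of_continuous_e key (fun z => Δ₆_eq z τ) ?_
    norm_num

lemma isModularForm_X₈ : IsModularForm 8 X₈ := by
  have hb := (isGammaTwoForm_e₂.const_smul 2).sub isGammaTwoForm_e₁
  have hc := (isGammaTwoForm_e₁.const_smul 2).sub isGammaTwoForm_e₂
  have hd := isGammaTwoForm_e₁.add isGammaTwoForm_e₂
  refine .of_generators (g := (1 / 1296 : ℂ) • (((2 : ℂ) • e₂ - e₁) * ((2 : ℂ) • e₂ - e₁) *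
    (((2 : ℂ) • e₁ - e₂) * (e₁ + e₂)))) (-1) ?_
    (fun γ hγ τ₁ τ₂ => ?_) (fun τ₁ τ₂ => ?_) (fun τ₁ τ₂ => ?_) (fun τ₁ τ₂ => ?_)
    (((hb.mul hb).mul (hc.mul hd)).const_smul _) (fun τ => ?_) (fun τ => ?_)
  · obtain ⟨h1, h2, h3, h4⟩ := differentiableOn_e rfl
    have key : ∀ {a b c d : ℂ × ℂ → ℂ} {U : Set (ℂ × ℂ)}, DifferentiableOn ℂ a U →
        DifferentiableOn ℂ b U → DifferentiableOn ℂ c U → DifferentiableOn ℂ d U →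
        DifferentiableOn ℂ (fun p => 1 / 81 * (a p * c p - b p * d p) * (a p * d p - b p * c p) *
          (a p * d p + b p * c p - a p * c p) * (a p * d p + b p * c p - b p * d p)) U := by
      intros; fun_prop
    exact key h1 h2 h3 h4
  · simp only [X₈, f₁₁, f₁₂, f₂₁, f₂₂, e₁_Gamma_two_smul hγ, e₂_Gamma_two_smul hγ, zpow_ofNat]
    ring
  · simp only [X₈, f₁₁, f₁₂, f₂₁, f₂₂, e₁_S_smul, e₂_S_smul, zpow_ofNat]
    ring
  · simp only [X₈, f₁₁, f₁₂, f₂₁, f₂₂, e₁_T_smul, e₂_T_smul]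
    ring
  · simp only [X₈, f₁₁, f₁₂, f₂₁, f₂₂]
    ring
  · simp only [Pi.smul_apply, Pi.mul_apply, Pi.add_apply, Pi.sub_apply, smul_eq_mul, e₁_T_smul,
      e₂_T_smul]
    ring
  · have key : Continuous fun p : ℂ × ℂ => 1 / 81 * (p.1 * e₁ τ - p.2 * e₂ τ) *
        (p.1 * e₂ τ - p.2 * e₁ τ) * (p.1 * e₂ τ + p.2 * e₁ τ - p.1 * e₁ τ) *
        (p.1 * e₂ τ + p.2 * e₁ τ - p.2 * e₂ τ) := by fun_prop
    refine tendsto_of_continuous_e key (fun z => rfl) ?_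
    simp only [Pi.smul_apply, Pi.mul_apply, Pi.add_apply, Pi.sub_apply, smul_eq_mul]
    ring

/-- Once `Δ₆` is factored into weight two forms, this is an identity between polynomials in four
free variables. -/
lemma X₈_sq_eq : X₈ ^ 2 = X₂ ^ 4 * X₄ ^ 2 - (128 : ℂ) • (X₂ ^ 2 * X₄ ^ 3) + (4096 : ℂ) • X₄ ^ 4 +
    (4 : ℂ) • (X₂ ^ 3 * X₄ * Δ₆) - (2304 : ℂ) • (X₂ * X₄ ^ 2 * Δ₆) -
    (6912 : ℂ) • (X₄ * Δ₆ ^ 2) := by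
  ext ⟨τ₁, τ₂⟩
  simp only [Pi.smul_apply, Pi.mul_apply, Pi.add_apply, Pi.sub_apply, Pi.pow_apply, smul_eq_mul,
    Δ₆_eq, X₂, X₄, X₈, f₁₁, f₁₂, f₂₁, f₂₂]
  ring

end Generators

/-! ### The Hironaka decomposition in the graded ring. -/

section Ring

open MvPolynomial (aeval)

/-- The generators of `M_*(G)` of weights `2, 4, 6`. -/
def generators : Fin 3 → MRing :=
  ![DirectSum.of (fun k : ℤ => M k) 2 ⟨X₂, isModularForm_X₂⟩,
    DirectSum.of (fun k : ℤ => M k) 4 ⟨X₄, isModularForm_X₄⟩,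
    DirectSum.of (fun k : ℤ => M k) 6 ⟨Δ₆, isModularForm_Δ₆⟩]

/-- The generator of `M_*(G)` of weight `8`. -/
def generatorEight : MRing := DirectSum.of (fun k : ℤ => M k) 8 ⟨X₈, isModularForm_X₈⟩

lemma toFunction_generators (i : Fin 3) :
    toFunction (generators i) = (![X₂, X₄, Δ₆] : Fin 3 → ℍ × ℍ → ℂ) i := by
  fin_cases i <;> exact toFunction_of _ _

lemma toFunction_generatorEight : toFunction generatorEight = X₈ := toFunction_of _ _

lemma toFunction_aeval (P : MvPolynomial (Fin 3) ℂ) :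
    toFunction (aeval generators P) = aeval ![X₂, X₄, Δ₆] P := by
  rw [MvPolynomial.comp_aeval_apply]
  congr 2
  exact funext toFunction_generators

/-- The exchange of the two variables. -/
def swapVars : (ℍ × ℍ → ℂ) →ₐ[ℂ] (ℍ × ℍ → ℂ) where
  toFun f := f ∘ Prod.swap
  map_one' := rfl
  map_mul' _ _ := rfl
  map_zero' := rfl
  map_add' _ _ := rfl
  commutes' _ := rfl

lemma swapVars_X₈ : swapVars X₈ = -X₈ := by
  ext p
  change X₈ (p.2, p.1) = -X₈ p
  simp only [X₈, f₁₁, f₁₂, f₂₁, f₂₂]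
  ring

lemma isSymm_generators (i : Fin 3) : IsSymm ((![X₂, X₄, Δ₆] : Fin 3 → ℍ × ℍ → ℂ) i) := by
  intro τ₁ τ₂
  fin_cases i
  · change X₂ _ = X₂ _
    simp only [X₂, f₁₁, f₁₂, f₂₁, f₂₂]; ring
  · change X₄ _ = X₄ _
    simp only [X₄, f₁₂, f₂₁]; ring
  · exact mul_comm _ _

lemma swapVars_aeval (P : MvPolynomial (Fin 3) ℂ) :
    swapVars (aeval ![X₂, X₄, Δ₆] P) = aeval ![X₂, X₄, Δ₆] P := by
  rw [MvPolynomial.comp_aeval_apply]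
  congr 2
  ext i p
  exact isSymm_generators i p.2 p.1

/-- The polynomial expressing `X₈²` in terms of `X₂, X₄, Δ₆`. -/
def squarePoly : MvPolynomial (Fin 3) ℂ :=
  .X 0 ^ 4 * .X 1 ^ 2 - 128 * .X 0 ^ 2 * .X 1 ^ 3 + 4096 * .X 1 ^ 4 +
    4 * .X 0 ^ 3 * .X 1 * .X 2 - 2304 * .X 0 * .X 1 ^ 2 * .X 2 - 6912 * .X 1 * .X 2 ^ 2

lemma squarePoly_ne_zero : squarePoly ≠ 0 := fun h => by
  have := congrArg (MvPolynomial.eval ![0, 1, 0]) h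
  simp [squarePoly] at this

lemma aeval_squarePoly : aeval ![X₂, X₄, Δ₆] squarePoly = X₈ ^ 2 := by
  rw [X₈_sq_eq]
  ext p
  simp [squarePoly, map_ofNat]
  ring

lemma generatorEight_sq : generatorEight ^ 2 = aeval generators squarePoly :=
  toFunction_injective (by
    rw [toFunction_aeval, aeval_squarePoly, map_pow, toFunction_generatorEight])

lemma eq_zero_of_aeval_add_eq_zero {P Q : MvPolynomial (Fin 3) ℂ}
    (h : aeval ![X₂, X₄, Δ₆] P + X₈ * aeval ![X₂, X₄, Δ₆] Q = 0) : P = 0 ∧ Q = 0 := by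
  have h' : aeval ![X₂, X₄, Δ₆] P + -X₈ * aeval ![X₂, X₄, Δ₆] Q = 0 := by
    simpa only [map_add, map_mul, map_zero, swapVars_aeval, swapVars_X₈] using
      congrArg swapVars h
  have hP : P = 0 := aeval_injective (by
    rw [map_zero]
    ext p
    have h1 := congrFun h p
    have h2 := congrFun h' p
    simp only [Pi.add_apply, Pi.mul_apply, Pi.neg_apply, Pi.zero_apply] at h1 h2 ⊢
    linear_combination (h1 + h2) / 2)
  -- Functions on ℍ × ℍ have zero divisors, so X₈ cannot simply be cancelled; multiplying by `X₈`
  -- again moves the equation into a polynomial ring, which is a domain.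
  have hQ : squarePoly * Q = 0 := aeval_injective (by
    rw [hP, map_zero, zero_add] at h
    rw [map_mul, aeval_squarePoly, map_zero]
    linear_combination X₈ * h)
  exact ⟨hP, (mul_eq_zero.mp hQ).resolve_left squarePoly_ne_zero⟩

lemma toFunction_mem_hironaka (F : MRing) : toFunction F ∈ hironaka := by
  induction F using DirectSum.induction_on with
  | zero => rw [map_zero]; exact zero_mem _
  | of k f => rw [toFunction_of]; exact IsModularForm.mem_hironaka f.2
  | add F F' h h' => rw [map_add]; exact add_mem h h'

lemma toFunction_aeval_add (P Q : MvPolynomial (Fin 3) ℂ) :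
    toFunction (aeval generators P + generatorEight * aeval generators Q) =
      aeval ![X₂, X₄, Δ₆] P + X₈ * aeval ![X₂, X₄, Δ₆] Q := by
  rw [map_add, map_mul, toFunction_aeval, toFunction_aeval, toFunction_generatorEight]

lemma exists_eq_aeval_add (F : MRing) : ∃ P Q : MvPolynomial (Fin 3) ℂ,
    F = aeval generators P + generatorEight * aeval generators Q := by
  obtain ⟨_, ⟨P, rfl⟩, _, ⟨Q, rfl⟩, h⟩ := toFunction_mem_hironaka F
  refine ⟨P, Q, toFunction_injective ?_⟩
  rw [toFunction_aeval_add, h]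
  rfl

theorem existsUnique_eq_aeval_add (F : MRing) :
    ∃! PQ : MvPolynomial (Fin 3) ℂ × MvPolynomial (Fin 3) ℂ,
      F = aeval generators PQ.1 + generatorEight * aeval generators PQ.2 := by
  obtain ⟨P, Q, rfl⟩ := exists_eq_aeval_add F
  refine ⟨(P, Q), rfl, ?_⟩
  rintro ⟨P', Q'⟩ h
  replace h := congrArg toFunction h
  rw [toFunction_aeval_add, toFunction_aeval_add] at h
  obtain ⟨hP, hQ⟩ := eq_zero_of_aeval_add_eq_zero (P := P' - P) (Q := Q' - Q) (by
    rw [map_sub, map_sub]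
    linear_combination -h)
  rw [sub_eq_zero.mp hP, sub_eq_zero.mp hQ]

/-- Gives the freeness of the antisymmetric module. A further factor `X₈` turns the equation into a
Hironaka relation with coefficients multiplied by `squarePoly`. -/
lemma mul_generatorEight_injective : Function.Injective fun F : MRing => F * generatorEight := by
  intro F F' h
  replace h := congrArg toFunction h
  obtain ⟨P, Q, rfl⟩ := exists_eq_aeval_add F
  obtain ⟨P', Q', rfl⟩ := exists_eq_aeval_add F'
  rw [map_mul, map_mul, toFunction_aeval_add, toFunction_aeval_add, toFunction_generatorEight] at h
  obtain ⟨hP, hQ⟩ := eq_zero_of_aeval_add_eq_zero (P := squarePoly * (P - P'))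
    (Q := squarePoly * (Q - Q')) (by
      rw [map_mul, map_mul, aeval_squarePoly, map_sub, map_sub]
      linear_combination X₈ * h)
  rw [sub_eq_zero.mp ((mul_eq_zero.mp hP).resolve_left squarePoly_ne_zero),
    sub_eq_zero.mp ((mul_eq_zero.mp hQ).resolve_left squarePoly_ne_zero)]

end Ring

/-! ### Antisymmetric forms as a free module of rank one. -/

section Antisymmetric

open MvPolynomial (aeval)

lemma of_mem_MSym {k : ℤ} {f : M k} (hf : IsSymm f) :
    DirectSum.of (fun k : ℤ => M k) k f ∈ MSym := by
  intro l
  by_cases h : l = k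
  · subst h; rwa [DirectSum.of_eq_same]
  · rw [DirectSum.of_eq_of_ne _ _ _ h]; exact fun _ _ => rfl

lemma aeval_generators_mem_MSym (P : MvPolynomial (Fin 3) ℂ) : aeval generators P ∈ MSym := by
  have h : Algebra.adjoin ℂ (Set.range generators) ≤ MSym := by
    rw [Algebra.adjoin_le_iff]
    rintro _ ⟨i, rfl⟩
    have := isSymm_generators i
    fin_cases i <;> exact of_mem_MSym this
  refine h ?_
  rw [Algebra.adjoin_range_eq_range_aeval]
  exact ⟨P, rfl⟩

lemma generatorEight_mem_MAnti : generatorEight ∈ MAnti := by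
  intro l τ₁ τ₂
  by_cases h : l = 8
  · subst h
    rw [generatorEight, DirectSum.of_eq_same]
    exact congrFun swapVars_X₈ (τ₂, τ₁)
  · rw [generatorEight, DirectSum.of_eq_of_ne _ _ _ h]
    simp

lemma swapVars_toFunction_of_mem_MAnti {F : MRing} (hF : F ∈ MAnti) :
    swapVars (toFunction F) = -toFunction F := by
  classical
  ext ⟨τ₁, τ₂⟩
  change toFunction F (τ₂, τ₁) = -toFunction F (τ₁, τ₂)
  rw [toFunction_apply, toFunction_apply, ← Finset.sum_neg_distrib]
  exact Finset.sum_congr rfl fun k _ => hF k τ₂ τ₁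

lemma exists_eq_mul_of_mem_MAnti {F : MRing} (hF : F ∈ MAnti) :
    ∃ s ∈ MSym, F = s * generatorEight := by
  obtain ⟨P, Q, rfl⟩ := exists_eq_aeval_add F
  have h := swapVars_toFunction_of_mem_MAnti hF
  simp only [map_add, map_mul, toFunction_aeval, toFunction_generatorEight, swapVars_aeval,
    swapVars_X₈] at h
  have hP : P = 0 := aeval_injective (by
    rw [map_zero]
    ext p
    have h1 := congrFun h p
    simp only [Pi.add_apply, Pi.mul_apply, Pi.neg_apply, Pi.zero_apply] at h1 ⊢
    linear_combination h1 / 2)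
  exact ⟨_, aeval_generators_mem_MSym Q, by rw [hP, map_zero, zero_add, mul_comm]⟩

theorem exists_basis_MAnti :
    ∃ b : Module.Basis Unit MSym MAnti, (b () : MRing) = generatorEight := by
  let f : MSym →ₗ[MSym] MAnti :=
    LinearMap.toSpanSingleton MSym MAnti ⟨generatorEight, generatorEight_mem_MAnti⟩
  have hf (s : MSym) : (f s : MRing) = s * generatorEight := rfl
  have hbij : Function.Bijective f := by
    refine ⟨fun s t h => Subtype.ext (mul_generatorEight_injective ?_), fun F => ?_⟩
    · exact (hf s).symm.trans ((congrArg _ h).trans (hf t))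
    · obtain ⟨s, hs, h⟩ := exists_eq_mul_of_mem_MAnti F.2
      exact ⟨⟨s, hs⟩, Subtype.ext h.symm⟩
  refine ⟨(Module.Basis.singleton Unit MSym).map (LinearEquiv.ofBijective f hbij), ?_⟩
  simp [hf]

end Antisymmetric

/-! ### Generators and the single relation. -/

section Presentation

open MvPolynomial (aeval)

/-- The four generators of `M_*(G)`. -/
def fourGenerators : Fin 4 → MRing :=
  ![generators 0, generators 1, generators 2, generatorEight]

/-- The inclusion of the polynomials in the first three variables. -/
def inclThree : MvPolynomial (Fin 3) ℂ →ₐ[ℂ] MvPolynomial (Fin 4) ℂ := aeval ![.X 0, .X 1, .X 2]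

lemma aeval_fourGenerators_inclThree (P : MvPolynomial (Fin 3) ℂ) :
    aeval fourGenerators (inclThree P) = aeval generators P := by
  rw [inclThree, MvPolynomial.comp_aeval_apply]
  congr 2
  ext1 i
  fin_cases i <;> simp [fourGenerators]

lemma aeval_inclThree_add (P Q : MvPolynomial (Fin 3) ℂ) :
    aeval fourGenerators (inclThree P + .X 3 * inclThree Q) =
      aeval generators P + generatorEight * aeval generators Q := by
  rw [map_add, map_mul, aeval_fourGenerators_inclThree, aeval_fourGenerators_inclThree,
    MvPolynomial.aeval_X]
  rfl

lemma R_eq : R = .X 3 ^ 2 - inclThree squarePoly := by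
  simp [R, inclThree, squarePoly, map_ofNat]

lemma aeval_R : aeval fourGenerators R = 0 := by
  rw [R_eq, map_sub, aeval_fourGenerators_inclThree, ← generatorEight_sq, map_pow]
  simp [fourGenerators]

/-- Division with remainder by `R` in the variable x₈. -/
lemma exists_sub_mem_span (p : MvPolynomial (Fin 4) ℂ) : ∃ P Q : MvPolynomial (Fin 3) ℂ,
    p - (inclThree P + .X 3 * inclThree Q) ∈ Ideal.span {R} := by
  simp only [Ideal.mem_span_singleton']
  induction p using MvPolynomial.induction_on with
  | C a => exact ⟨.C a, 0, 0, by simp [inclThree]⟩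
  | add p q hp hq =>
    obtain ⟨P, Q, r, h⟩ := hp
    obtain ⟨P', Q', r', h'⟩ := hq
    refine ⟨P + P', Q + Q', r + r', ?_⟩
    rw [map_add, map_add]
    linear_combination h + h'
  | mul_X p i hp =>
    obtain ⟨P, Q, r, h⟩ := hp
    have key (j : Fin 3) (i : Fin 4) (hi : inclThree (.X j) = .X i) :
        ∃ P Q r, r * R = p * .X i - (inclThree P + .X 3 * inclThree Q) := by
      refine ⟨P * .X j, Q * .X j, r * .X i, ?_⟩
      rw [map_mul, map_mul, hi]
      linear_combination .X i * h
    fin_cases i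
    · exact key 0 _ (by simp [inclThree])
    · exact key 1 _ (by simp [inclThree])
    · exact key 2 _ (by simp [inclThree])
    -- Modulo `R`, (P + x₈Q)x₈ = squarePoly·Q + x₈P.
    · refine ⟨squarePoly * Q, P, r * .X 3 + inclThree Q, ?_⟩
      rw [map_mul]
      change _ = p * .X 3 - _
      linear_combination .X 3 * h + inclThree Q * R_eq

/-- The remainder of a kernel element is a Hironaka expression of 0, hence zero by uniqueness. -/
lemma ker_aeval_fourGenerators :
    RingHom.ker (aeval fourGenerators : MvPolynomial (Fin 4) ℂ →ₐ[ℂ] MRing) = Ideal.span {R} := by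
  apply le_antisymm
  · intro p hp
    obtain ⟨P, Q, h⟩ := exists_sub_mem_span p
    obtain ⟨r, hr⟩ := Ideal.mem_span_singleton'.mp h
    have h1 := congrArg toFunction ((RingHom.mem_ker).mp hp)
    rw [sub_eq_iff_eq_add.mp hr.symm, map_add, map_mul, aeval_R, mul_zero, zero_add,
      aeval_inclThree_add, toFunction_aeval_add, map_zero] at h1
    obtain ⟨rfl, rfl⟩ := eq_zero_of_aeval_add_eq_zero h1
    simpa using h
  · rw [Ideal.span_singleton_le_iff_mem]
    exact aeval_R

lemma aeval_fourGenerators_surjective :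
    Function.Surjective (aeval fourGenerators : MvPolynomial (Fin 4) ℂ →ₐ[ℂ] MRing) := fun F => by
  obtain ⟨P, Q, rfl⟩ := exists_eq_aeval_add F
  refine ⟨inclThree P + .X 3 * inclThree Q, ?_⟩
  rw [aeval_inclThree_add]

theorem exists_presentation : ∃ φ : (MvPolynomial (Fin 4) ℂ ⧸ Ideal.span {R}) ≃ₐ[ℂ] MRing,
    ∀ i, φ (Ideal.Quotient.mk _ (MvPolynomial.X i)) = fourGenerators i :=
  ⟨(Ideal.quotientEquivAlgOfEq ℂ ker_aeval_fourGenerators.symm).trans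
    (Ideal.quotientKerAlgEquivOfSurjective aeval_fourGenerators_surjective), fun i => by
      simp⟩

end Presentation

end DegenerateHilbert

end

open DegenerateHilbert in
theorem mainTheorem7 :
    ∃ (h₂ : X₂ ∈ M 2) (h₄ : X₄ ∈ M 4) (h₆ : Δ₆ ∈ M 6) (h₈ : X₈ ∈ M 8),
      let x₂ : MRing := DirectSum.of (fun k : ℤ => M k) 2 ⟨X₂, h₂⟩
      let x₄ : MRing := DirectSum.of (fun k : ℤ => M k) 4 ⟨X₄, h₄⟩
      let d₆ : MRing := DirectSum.of (fun k : ℤ => M k) 6 ⟨Δ₆, h₆⟩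
      let x₈ : MRing := DirectSum.of (fun k : ℤ => M k) 8 ⟨X₈, h₈⟩
      -- the antisymmetric forms are free over the symmetric ones, on the generator `X₈`
      (∃ b : Module.Basis Unit MSym MAnti, (b () : MRing) = x₈) ∧
      -- the Hironaka decomposition of the full ring
      (∀ F : MRing, ∃! PQ : MvPolynomial (Fin 3) ℂ × MvPolynomial (Fin 3) ℂ,
        F = MvPolynomial.aeval ![x₂, x₄, d₆] PQ.1 +
          x₈ * MvPolynomial.aeval ![x₂, x₄, d₆] PQ.2) ∧
      -- the presentation of the full ring
      (∃ φ : (MvPolynomial (Fin 4) ℂ ⧸ Ideal.span {R}) ≃ₐ[ℂ] MRing,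
        φ (Ideal.Quotient.mk _ (MvPolynomial.X 0)) = x₂ ∧
        φ (Ideal.Quotient.mk _ (MvPolynomial.X 1)) = x₄ ∧
        φ (Ideal.Quotient.mk _ (MvPolynomial.X 2)) = d₆ ∧
        φ (Ideal.Quotient.mk _ (MvPolynomial.X 3)) = x₈) := by
  obtain ⟨φ, hφ⟩ := exists_presentation
  refine ⟨isModularForm_X₂, isModularForm_X₄, isModularForm_Δ₆, isModularForm_X₈,
    exists_basis_MAnti, existsUnique_eq_aeval_add, φ, ?_⟩
  exact ⟨hφ 0, hφ 1, hφ 2, hφ 3⟩
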